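/- **Setting.** Let $\mathcal X,\mathcal Y_1,\mathcal Y_2,\mathcal V_1,\mathcal V_2$ be finite alphabets, $P_{XY_1Y_2}$ a probability distribution on $\mathcal X\times\mathcal Y_1\times\mathcal Y_2$ with $\mathcal X$-marginal $P_X$, and $P_{V_1|X}$, $P_{V_2|X}$ conditional distributions on $\mathcal V_1$, $\mathcal V_2$ given $x\in\mathcal X$. Put $P_{XV_i}(x,v)=P_X(x)P_{V_i|X}(v|x)$. For a distribution $P$ on a finite set $\mathcal A$, let $\mathcal T^n_\varepsilon(P)$ be the set of $a^n\in\mathcal A^n$ whose relative frequencies $\pi_{a^n}$ satisfy $|\pi_{a^n}(a)-P(a)|\le\varepsilon P(a)$ for all $a\in\mathcal A$. Write $[M]=\{1,\dots,\lfloor M\rfloor\}$; information quantities are in bits. **Lossy Gray–Wyner coding with side information.** Let $(X_t,Y_{1,t},Y_{2,t})$, $t=1,2,\dots$, be i.i.d. with law $P_{XY_1Y_2}$. A code of blocklength $n$ and rates $(R_0,R_1,R_2)$ consists of an encoder $\lambda^{(n)}:\mathcal X^n\to[2^{nR_0}]\times[2^{nR_1}]\times[2^{nR_2}]$ and decoders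 $\Lambda_i^{(n)}:[2^{nR_0}]\times[2^{nR_i}]\times\mathcal Y_i^n\to\mathcal V_i^n$, $i\in\{1,2\}$; with $(K_0,K_1,K_2)=\lambda^{(n)}(X^n)$, Receiver $i$ reconstructs $\hat V_i^n=\Lambda_i^{(n)}(K_0,K_i,Y_i^n)$. A nonnegative rate triplet $(R_0,R_1,R_2)$ is *$\varepsilon$-achievable* if for some sequence of such codes $$\Pr\big((X^n,\hat V_i^n)\notin\mathcal T^n_\varepsilon(P_{XV_i})\big)\to0\quad(n\to\infty),\qquad i\in\{1,2\},$$ and *achievable* if it is $\varepsilon$-achievable for every $\varepsilon>0$. Let $\mathcal R_{\mathrm{LGW}}$ be the closure of the set of achievable triplets. **Inner regions.** Call $V_0$ *admissible* if it is a random variable with a finite alphabet, defined jointly with $V_1,V_2,X,Y_1,Y_2$ so that $(X,Y_1,Y_2)\sim P_{XY_1Y_2}$, $(X,V_i)\sim P_{XV_i}$ for $i\in\{1,2\}$, and $(V_0,V_1,V_2)-X-(Y_1,Y_2)$ is a Markov chain. Let $\mathcal R_{\mathrm{LGW}}^{\mathrm{inner}}$ be the closure of the set of all nonnegative triplets $(R_0,R_1,R_2)$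 such that, for some admissible $V_0$, $$R_1>I(X;V_1|V_0,Y_1),\qquad R_2>I(X;V_2|V_0,Y_2),$$ $$R_0+R_1>I(X;V_0,V_1|Y_1),\qquad R_0+R_2>I(X;V_0,V_2|Y_2).$$ Let $\mathcal R_{\mathrm{LGW}}^{\mathrm{inner}*}$ be the closure of the set of all nonnegative triplets such that, for some admissible $V_0$, $$R_0>\max_{i\in\{1,2\}}I(X;V_0|Y_i),\qquad R_1>I(X;V_1|V_0,Y_1),\qquad R_2>I(X;V_2|V_0,Y_2).$$ **Theorem.** $\mathcal R_{\mathrm{LGW}}^{\mathrm{inner}*}\subseteq\mathcal R_{\mathrm{LGW}}^{\mathrm{inner}}\subseteq\mathcal R_{\mathrm{LGW}}$, and $\mathcal R_{\mathrm{LGW}}^{\mathrm{inner}}$ is convex. -/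

import Mathlib

open Set Filter Topology

namespace LGW

noncomputable section

/-! ### Finite probability: laws, Markov chains, conditional mutual information

A probability mass function on a finite type `α` is a function `p : α → ℝ` with
`p ∈ stdSimplex ℝ α`. Random variables are functions on a finite sample space `Ω` that carries a
probability mass function `p`; several random variables are combined with `fun ω => (A ω, B ω)`. -/

section Finite

variable {Ω : Type*} [Fintype Ω] {α β γ : Type*}

open Classical in
/-- The probability of the event `E` under the probability mass function `p`. -/
def prob (p : Ω → ℝ) (E : Set Ω) : ℝ := ∑ ω, if ω ∈ E then p ω else 0

/-- The law of the random variable `A`: `law p A a = Pr(A = a)`. -/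
def law (p : Ω → ℝ) (A : Ω → α) (a : α) : ℝ := prob p {ω | A ω = a}

/-- The Markov chain `A → B → C`: `A` and `C` are conditionally independent given `B`. -/
def MarkovChain (p : Ω → ℝ) (A : Ω → α) (B : Ω → β) (C : Ω → γ) : Prop :=
  ∀ a b c, law p (fun ω => (A ω, B ω, C ω)) (a, b, c) * law p B b =
    law p (fun ω => (A ω, B ω)) (a, b) * law p (fun ω => (B ω, C ω)) (b, c)

/-- The conditional mutual information `I(A; B | C)`, in bits. A triple `(a, b, c)` of
probability zero contributes `0`; for every other triple the argument of the logarithm is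
a quotient of positive numbers. -/
def condMutualInfo [Fintype α] [Fintype β] [Fintype γ] (p : Ω → ℝ)
    (A : Ω → α) (B : Ω → β) (C : Ω → γ) : ℝ :=
  ∑ a, ∑ b, ∑ c, law p (fun ω => (A ω, B ω, C ω)) (a, b, c) *
    Real.logb 2
      (law p (fun ω => (A ω, B ω, C ω)) (a, b, c) * law p C c /
        (law p (fun ω => (A ω, C ω)) (a, c) * law p (fun ω => (B ω, C ω)) (b, c)))

end Finite

section Typicality

variable {α : Type*}

open Classical in
/-- Relative frequency of the symbol `a` in the sequence `x`. -/
def relFreq {n : ℕ} (x : Fin n → α) (a : α) : ℝ :=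
  ((Finset.univ.filter fun t => x t = a).card : ℝ) / n

/-- The set of `ε`-typical sequences of length `n` with respect to `p` (robust typicality).
Joint typicality is the case where `α` is a product. -/
def typicalSet (n : ℕ) (ε : ℝ) (p : α → ℝ) : Set (Fin n → α) :=
  {x | ∀ a, |relFreq x a - p a| ≤ ε * p a}

/-- The probability mass function of `n` independent copies of `p`. -/
def iidLaw (p : α → ℝ) (n : ℕ) (x : Fin n → α) : ℝ := ∏ t, p (x t)

end Typicality

/-! ### The source coding problem -/

section Problem

variable {𝒳 𝒴₁ 𝒴₂ 𝒱₁ 𝒱₂ : Type*}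
  [Fintype 𝒳] [Fintype 𝒴₁] [Fintype 𝒴₂] [Fintype 𝒱₁] [Fintype 𝒱₂]

/-- `P_{XV}(x, v) = P_X(x) P_{V|X}(v | x)`, where `P_X` is the first marginal of `P_{XY₁Y₂}`. -/
def sourceRecLaw {𝒱 : Type*} (P : 𝒳 × 𝒴₁ × 𝒴₂ → ℝ) (W : 𝒳 → 𝒱 → ℝ) : 𝒳 × 𝒱 → ℝ :=
  fun xv => law P Prod.fst xv.1 * W xv.1 xv.2

/-- The number `⌊2 ^ (n R)⌋` of messages at rate `R` and blocklength `n`. -/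
def numMessages (n : ℕ) (R : ℝ) : ℕ := ⌊(2 : ℝ) ^ ((n : ℝ) * R)⌋₊

/-- A code of blocklength `n` and rates `(R₀, R₁, R₂)`: the encoder produces the common message
and the two private messages from the source sequence; Receiver `i` reconstructs from the common
message, its private message, and its side-information sequence. -/
structure Code (𝒳 𝒴₁ 𝒴₂ 𝒱₁ 𝒱₂ : Type*) (n : ℕ) (R : ℝ × ℝ × ℝ) where
  enc : (Fin n → 𝒳) →
    Fin (numMessages n R.1) × Fin (numMessages n R.2.1) × Fin (numMessages n R.2.2)
  dec₁ : Fin (numMessages n R.1) → Fin (numMessages n R.2.1) → (Fin n → 𝒴₁) → (Fin n → 𝒱₁)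
  dec₂ : Fin (numMessages n R.1) → Fin (numMessages n R.2.2) → (Fin n → 𝒴₂) → (Fin n → 𝒱₂)

namespace Code

variable {n : ℕ} {R : ℝ × ℝ × ℝ}

/-- Receiver 1's reconstruction when the source and side-information sequences are `s`. -/
def rec₁ (c : Code 𝒳 𝒴₁ 𝒴₂ 𝒱₁ 𝒱₂ n R) (s : Fin n → 𝒳 × 𝒴₁ × 𝒴₂) : Fin n → 𝒱₁ :=
  let k := c.enc fun t => (s t).1
  c.dec₁ k.1 k.2.1 fun t => (s t).2.1

/-- Receiver 2's reconstruction when the source and side-information sequences are `s`. -/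
def rec₂ (c : Code 𝒳 𝒴₁ 𝒴₂ 𝒱₁ 𝒱₂ n R) (s : Fin n → 𝒳 × 𝒴₁ × 𝒴₂) : Fin n → 𝒱₂ :=
  let k := c.enc fun t => (s t).1
  c.dec₂ k.1 k.2.2 fun t => (s t).2.2

end Code

/-- `ε`-achievability: for some sequence of codes, and for both receivers, the probability that
the source sequence and the reconstruction are not jointly `ε`-typical tends to zero. -/
def EpsAchievable (P : 𝒳 × 𝒴₁ × 𝒴₂ → ℝ) (W₁ : 𝒳 → 𝒱₁ → ℝ) (W₂ : 𝒳 → 𝒱₂ → ℝ)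
    (ε : ℝ) (R : ℝ × ℝ × ℝ) : Prop :=
  ∃ c : ∀ n, Code 𝒳 𝒴₁ 𝒴₂ 𝒱₁ 𝒱₂ n R,
    Tendsto (fun n => prob (iidLaw P n)
      {s | (fun t => ((s t).1, (c n).rec₁ s t)) ∉ typicalSet n ε (sourceRecLaw P W₁)})
      atTop (𝓝 0) ∧
    Tendsto (fun n => prob (iidLaw P n)
      {s | (fun t => ((s t).1, (c n).rec₂ s t)) ∉ typicalSet n ε (sourceRecLaw P W₂)})
      atTop (𝓝 0)

/-- A triplet of nonnegative real numbers. -/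
def NonnegTriple (R : ℝ × ℝ × ℝ) : Prop := 0 ≤ R.1 ∧ 0 ≤ R.2.1 ∧ 0 ≤ R.2.2

/-- The closure of the set of achievable rate triplets. -/
def regionLGW (P : 𝒳 × 𝒴₁ × 𝒴₂ → ℝ) (W₁ : 𝒳 → 𝒱₁ → ℝ) (W₂ : 𝒳 → 𝒱₂ → ℝ) :
    Set (ℝ × ℝ × ℝ) :=
  closure {R | NonnegTriple R ∧ ∀ ε > 0, EpsAchievable P W₁ W₂ ε R}

/-- On the finite probability space `(Ω, p)`, the random variables satisfy
`(X, Y₁, Y₂) ∼ P_{XY₁Y₂}`, `(X, Vᵢ) ∼ P_X P_{Vᵢ|X}` and the Markov chain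
`(V₀, V₁, V₂) → X → (Y₁, Y₂)`. -/
structure IsAuxiliary {Ω 𝒱₀ : Type*} [Fintype Ω]
    (P : 𝒳 × 𝒴₁ × 𝒴₂ → ℝ) (W₁ : 𝒳 → 𝒱₁ → ℝ) (W₂ : 𝒳 → 𝒱₂ → ℝ) (p : Ω → ℝ)
    (X : Ω → 𝒳) (Y₁ : Ω → 𝒴₁) (Y₂ : Ω → 𝒴₂)
    (V₀ : Ω → 𝒱₀) (V₁ : Ω → 𝒱₁) (V₂ : Ω → 𝒱₂) : Prop where
  pmf : p ∈ stdSimplex ℝ Ω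
  law_source : law p (fun ω => (X ω, Y₁ ω, Y₂ ω)) = P
  law_rec₁ : law p (fun ω => (X ω, V₁ ω)) = sourceRecLaw P W₁
  law_rec₂ : law p (fun ω => (X ω, V₂ ω)) = sourceRecLaw P W₂
  markov : MarkovChain p (fun ω => (V₀ ω, V₁ ω, V₂ ω)) X (fun ω => (Y₁ ω, Y₂ ω))

/-- The inner region: closure of the nonnegative rate triplets that satisfy the four rate
constraints for some auxiliary random variable `V₀` with a finite alphabet. -/
def regionInner (P : 𝒳 × 𝒴₁ × 𝒴₂ → ℝ) (W₁ : 𝒳 → 𝒱₁ → ℝ) (W₂ : 𝒳 → 𝒱₂ → ℝ) :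
    Set (ℝ × ℝ × ℝ) :=
  closure {R | NonnegTriple R ∧
    ∃ (Ω 𝒱₀ : Type) (_ : Fintype Ω) (_ : Fintype 𝒱₀) (p : Ω → ℝ)
      (X : Ω → 𝒳) (Y₁ : Ω → 𝒴₁) (Y₂ : Ω → 𝒴₂)
      (V₀ : Ω → 𝒱₀) (V₁ : Ω → 𝒱₁) (V₂ : Ω → 𝒱₂),
      IsAuxiliary P W₁ W₂ p X Y₁ Y₂ V₀ V₁ V₂ ∧
      condMutualInfo p X V₁ (fun ω => (V₀ ω, Y₁ ω)) < R.2.1 ∧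
      condMutualInfo p X V₂ (fun ω => (V₀ ω, Y₂ ω)) < R.2.2 ∧
      condMutualInfo p X (fun ω => (V₀ ω, V₁ ω)) Y₁ < R.1 + R.2.1 ∧
      condMutualInfo p X (fun ω => (V₀ ω, V₂ ω)) Y₂ < R.1 + R.2.2}

/-- The simplified inner region: closure of the nonnegative rate triplets that satisfy
`R₀ > max_i I(X; V₀ | Yᵢ)` and `Rᵢ > I(X; Vᵢ | V₀, Yᵢ)` for some auxiliary random variable `V₀`
with a finite alphabet. -/
def regionInnerStar (P : 𝒳 × 𝒴₁ × 𝒴₂ → ℝ) (W₁ : 𝒳 → 𝒱₁ → ℝ) (W₂ : 𝒳 → 𝒱₂ → ℝ) :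
    Set (ℝ × ℝ × ℝ) :=
  closure {R | NonnegTriple R ∧
    ∃ (Ω 𝒱₀ : Type) (_ : Fintype Ω) (_ : Fintype 𝒱₀) (p : Ω → ℝ)
      (X : Ω → 𝒳) (Y₁ : Ω → 𝒴₁) (Y₂ : Ω → 𝒴₂)
      (V₀ : Ω → 𝒱₀) (V₁ : Ω → 𝒱₁) (V₂ : Ω → 𝒱₂),
      IsAuxiliary P W₁ W₂ p X Y₁ Y₂ V₀ V₁ V₂ ∧
      max (condMutualInfo p X V₀ Y₁) (condMutualInfo p X V₀ Y₂) < R.1 ∧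
      condMutualInfo p X V₁ (fun ω => (V₀ ω, Y₁ ω)) < R.2.1 ∧
      condMutualInfo p X V₂ (fun ω => (V₀ ω, Y₂ ω)) < R.2.2}

end Problem

end

end LGW

/-! The starred region lies in the inner region by the chain rule I(X;V₀,Vᵢ|Yᵢ) = I(X;V₀|Yᵢ) +
I(X;Vᵢ|V₀,Yᵢ). Convexity is time sharing: if V₀ also records which of two auxiliary systems is in
force, the information quantities average (`condMutualInfo_mixture`, `condMutualInfo_mixture_pair`).

Achievability is superposition coding with binning. Draw about 2^{nI(X;V₀)} common codewords and,
for each, about 2^{nI(X;Vᵢ|V₀)} private ones; the encoder looks for codewords that fit the source.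
It sends a hash of the common codeword and, for each receiver, a hash of the pair of common and
private codeword. A pair with a wrong common codeword fits the side information with probability
about 2^{-nI(V₀,Vᵢ;Yᵢ)} and must collide under both hashes; a pair with the right one fits with
probability about 2^{-nI(Vᵢ;Yᵢ|V₀)} and must collide under the private hash only. So it suffices
that R₀+Rᵢ > I(X;V₀,Vᵢ) − I(V₀,Vᵢ;Yᵢ) and Rᵢ > I(X;Vᵢ|V₀) − I(Vᵢ;Yᵢ|V₀). By the Markov chain the
right sides are I(X;V₀,Vᵢ|Yᵢ) and I(X;Vᵢ|V₀,Yᵢ).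

The argument is first made for a single use of an arbitrary finite source (`one_shot`), with
likelihood-ratio tests. Covering is `cover_average`: the best of many samples of a codebook law
costs hardly more than one sample of the ideal law. The cost may be a failure probability over side
information that the encoder does not see, so no separate Markov lemma is needed. Binning is
`exists_hash`. For blocks, the weak law makes the tests succeed (`tendsto_test`),
`epsAchievable_of_rateData` balances the exponents, and `exists_receiverKernel` identifies them with
information quantities. -/

namespace LGW

/-! ### Expectations over product laws -/

open Classical in
/-- The indicator of a proposition, as a real number. -/
noncomputable def ind (p : Prop) : ℝ := if p then 1 else 0

lemma ind_nonneg (p : Prop) : 0 ≤ ind p := by unfold ind; split_ifs <;> norm_num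

lemma ind_le_one (p : Prop) : ind p ≤ 1 := by unfold ind; split_ifs <;> norm_num

lemma ind_true {p : Prop} (h : p) : ind p = 1 := by simp [ind, h]

lemma ind_false {p : Prop} (h : ¬ p) : ind p = 0 := by simp [ind, h]

lemma ind_mono {p q : Prop} (h : p → q) : ind p ≤ ind q := by
  by_cases hp : p
  · rw [ind_true hp, ind_true (h hp)]
  · rw [ind_false hp]; exact ind_nonneg q

lemma ind_or_le (p q : Prop) : ind (p ∨ q) ≤ ind p + ind q := by
  by_cases hp : p <;> by_cases hq : q <;> simp [ind, hp, hq]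

lemma ind_and (p q : Prop) : ind (p ∧ q) = ind p * ind q := by
  by_cases hp : p <;> by_cases hq : q <;> simp [ind, hp, hq]

lemma sum_mul_ind_nonneg {V : Type*} [Fintype V] {q : V → ℝ} (hq : q ∈ stdSimplex ℝ V)
    (P : V → Prop) : 0 ≤ ∑ v, q v * ind (P v) :=
  Finset.sum_nonneg fun v _ => mul_nonneg (hq.1 v) (ind_nonneg _)

lemma sum_mul_ind_le_one {V : Type*} [Fintype V] {q : V → ℝ} (hq : q ∈ stdSimplex ℝ V)
    (P : V → Prop) : ∑ v, q v * ind (P v) ≤ 1 := by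
  rw [← hq.2]
  exact Finset.sum_le_sum fun v _ => mul_le_of_le_one_right (hq.1 v) (ind_le_one _)

lemma sum_mul_ind_eq_one {V : Type*} [Fintype V] {q : V → ℝ} (hq : q ∈ stdSimplex ℝ V)
    {P : V → Prop} (hP : ∀ v, P v) : ∑ v, q v * ind (P v) = 1 := by
  simp [ind_true (hP _), hq.2]

section Product

variable {ι β : Type*} [Fintype ι] [DecidableEq ι] [Fintype β]

lemma sum_prod_pi (F : ι → β → ℝ) :
    ∑ f : ι → β, ∏ i, F i (f i) = ∏ i, ∑ b, F i b := by
  classical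
  exact (Fintype.prod_sum F).symm

lemma sum_prod_pi_eq_one (w : ι → β → ℝ) (hw : ∀ i, ∑ b, w i b = 1) :
    ∑ f : ι → β, ∏ i, w i (f i) = 1 := by
  rw [sum_prod_pi]; simp [hw]

/-- The expectation of a function of one coordinate under a product law. -/
lemma sum_prod_pi_mul_apply (w : ι → β → ℝ) (hw : ∀ i, ∑ b, w i b = 1) (i₀ : ι) (F : β → ℝ) :
    ∑ f : ι → β, (∏ i, w i (f i)) * F (f i₀) = ∑ b, w i₀ b * F b := by
  classical
  have h := sum_prod_pi (fun i b => w i b * if i = i₀ then F b else 1)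
  simp only [Finset.prod_mul_distrib] at h
  have h1 : ∀ f : ι → β, (∏ i, if i = i₀ then F (f i) else 1) = F (f i₀) := by
    intro f; simp
  simp only [h1] at h
  rw [h, Finset.prod_eq_single i₀]
  · simp
  · intro i _ hi; simp [hi, hw]
  · simp

/-- Distinct coordinates are independent under a product law. -/
lemma sum_prod_pi_mul_apply_mul_apply (w : ι → β → ℝ) (hw : ∀ i, ∑ b, w i b = 1)
    {i₀ i₁ : ι} (hne : i₀ ≠ i₁) (F G : β → ℝ) :
    ∑ f : ι → β, (∏ i, w i (f i)) * (F (f i₀) * G (f i₁)) =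
      (∑ b, w i₀ b * F b) * ∑ b, w i₁ b * G b := by
  classical
  have h := sum_prod_pi
    (fun i b => w i b * ((if i = i₀ then F b else 1) * (if i = i₁ then G b else 1)))
  simp only [Finset.prod_mul_distrib] at h
  have h1 : ∀ f : ι → β, (∏ i, if i = i₀ then F (f i) else 1) = F (f i₀) := by
    intro f; simp
  have h2 : ∀ f : ι → β, (∏ i, if i = i₁ then G (f i) else 1) = G (f i₁) := by
    intro f; simp
  simp only [h1, h2] at h
  rw [h, ← Finset.prod_subset (Finset.subset_univ {i₀, i₁}), Finset.prod_pair hne]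
  · simp [hne, hne.symm]
  · intro i _ hi
    simp only [Finset.mem_insert, Finset.mem_singleton, not_or] at hi
    simp [hi.1, hi.2, hw]

/-- If an average is at most `b`, so is one of the averaged values. -/
lemma exists_le_of_average_le {ι : Type*} [Fintype ι] (w F : ι → ℝ) (hw0 : ∀ i, 0 ≤ w i)
    (hw : ∑ i, w i = 1)
    {b : ℝ} (h : ∑ i, w i * F i ≤ b) : ∃ i, F i ≤ b := by
  by_contra! hcon
  have h1 : ∑ i, w i * b ≤ ∑ i, w i * F i :=
    Finset.sum_le_sum fun i _ => mul_le_mul_of_nonneg_left (hcon i).le (hw0 i)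
  rw [← Finset.sum_mul, hw, one_mul] at h1
  have h2 : ∑ i, w i * (F i - b) = 0 := by
    simp only [mul_sub, Finset.sum_sub_distrib, ← Finset.sum_mul, hw, one_mul]; linarith
  rw [Finset.sum_eq_zero_iff_of_nonneg
    (fun i _ => mul_nonneg (hw0 i) (sub_nonneg.2 (hcon i).le))] at h2
  have h3 : ∀ i, w i = 0 := fun i => by
    rcases mul_eq_zero.1 (h2 i (Finset.mem_univ i)) with h | h
    · exact h
    · linarith [hcon i]
  simp [h3] at hw

end Product

/-! ### Random hashing and random covering -/

section Random

variable {S 𝒳 A V W : Type*} [Fintype S] [Fintype 𝒳] [Fintype A] [DecidableEq A] [Fintype V]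
  [Fintype W] [DecidableEq W]

/-- Split by the common hash value: two distinct coordinates are independent, so each of the `B`
values contributes 1 / B². -/
lemma sum_uniform_ind_eq {B : ℕ} (hB : 0 < B) {a b : A} (hab : b ≠ a) :
    ∑ f : A → Fin B, (∏ _i : A, (1 / B : ℝ)) * ind (f b = f a) = 1 / B := by
  have hB' : (B : ℝ) ≠ 0 := by positivity
  have hw : ∀ _ : A, ∑ _b : Fin B, (1 / B : ℝ) = 1 := fun _ => by simp [hB']
  have h1 : ∀ f : A → Fin B, ind (f b = f a) = ∑ k : Fin B, ind (f b = k) * ind (f a = k) := by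
    intro f; simp [ind, eq_comm]
  simp only [h1, Finset.mul_sum]
  rw [Finset.sum_comm]
  have h2 : ∀ k : Fin B, ∑ f : A → Fin B, (∏ _i : A, (1 / B : ℝ)) *
      (ind (f b = k) * ind (f a = k)) = 1 / B * (1 / B) := by
    intro k
    rw [sum_prod_pi_mul_apply_mul_apply (fun _ _ => (1 / B : ℝ)) hw hab
      (fun c => ind (c = k)) (fun c => ind (c = k))]
    simp [ind]
  simp only [h2, Finset.sum_const, Finset.card_univ, Fintype.card_fin, nsmul_eq_mul]
  field_simp

/-- Some hash function performs at least as well as a uniformly random one: the weight of the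
elements that collide with the designated elements is at most a fraction `1 / B` of the total. -/
lemma exists_hash {B : ℕ} (hB : 0 < B) (a : S → A) (k : S → A → ℝ) (hk : ∀ s b, 0 ≤ k s b) :
    ∃ f : A → Fin B, ∑ s, ∑ b, k s b * ind (b ≠ a s ∧ f b = f (a s)) ≤
      1 / B * ∑ s, ∑ b, k s b := by
  have hB' : (B : ℝ) ≠ 0 := by positivity
  refine exists_le_of_average_le (fun _ : A → Fin B => ∏ _i : A, (1 / B : ℝ)) _
    (fun _ => by positivity)
    (sum_prod_pi_eq_one (fun _ _ => (1 / B : ℝ)) fun _ => by simp [hB']) ?_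
  simp only [Finset.mul_sum]
  rw [Finset.sum_comm]
  refine Finset.sum_le_sum fun s _ => ?_
  rw [Finset.sum_comm]
  refine Finset.sum_le_sum fun b _ => ?_
  by_cases hb : b = a s
  · simp only [hb, ne_eq, not_true_eq_false, false_and, ind_false not_false, mul_zero,
      Finset.sum_const_zero]
    exact mul_nonneg (by positivity) (hk _ _)
  · simp only [ne_eq, hb, not_false_eq_true, true_and]
    have h := congrArg (k s b * ·) (sum_uniform_ind_eq (A := A) hB hb)
    simp only [Finset.mul_sum] at h
    refine le_of_eq (Eq.trans (Finset.sum_congr rfl fun f _ => by ring) (h.trans (mul_comm _ _)))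

/-- Random covering: `M` independent samples of `r` contain, up to the error `m (1 - 1/L) ^ M`,
one that is at least as good as a sample of `q`. -/
lemma cover_average (q r φ : V → ℝ) (hq0 : ∀ v, 0 ≤ q v) (hq : ∑ v, q v = 1)
    (hr0 : ∀ v, 0 ≤ r v) (hr : ∑ v, r v = 1) {m L : ℝ} (hL : 1 ≤ L)
    (hφ0 : ∀ v, 0 ≤ φ v) (hφ : ∀ v, φ v = m ∨ q v ≤ L * r v) (M : ℕ) :
    ∀ G : (Fin M → V) → ℝ, (∀ c, G c ≤ m) → (∀ c j, G c ≤ φ (c j)) →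
      ∑ c : Fin M → V, (∏ j, r (c j)) * G c ≤ ∑ v, q v * φ v + m * (1 - 1 / L) ^ M := by
  induction M with
  | zero =>
    intro G hG _
    have : 0 ≤ ∑ v, q v * φ v := Finset.sum_nonneg fun v _ => mul_nonneg (hq0 v) (hφ0 v)
    simp only [Finset.univ_unique, Finset.univ_eq_empty, Finset.prod_empty, one_mul,
      Finset.sum_singleton, pow_zero, mul_one]
    linarith [hG default]
  | succ M ih =>
    intro G hGm hGφ
    set e : ℝ := ∑ v, q v * φ v with he
    -- The bound for the remaining samples; the cap at `m` is needed in the case `φ v = m` of `key`.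
    set f : ℝ := min (e + m * (1 - 1 / L) ^ M) m with hf
    set H : V → ℝ := fun v => ∑ c : Fin M → V, (∏ j, r (c j)) * G (Fin.cons v c) with hH
    have hsum : ∑ c : Fin M → V, ∏ j, r (c j) = 1 := sum_prod_pi_eq_one (fun _ => r) fun _ => hr
    have hw : ∀ c : Fin M → V, 0 ≤ ∏ j, r (c j) := fun c => Finset.prod_nonneg fun _ _ => hr0 _
    have hHle : ∀ v, ∀ b, (∀ c, G (Fin.cons v c) ≤ b) → H v ≤ b := by
      intro v b hb
      calc H v ≤ ∑ c : Fin M → V, (∏ j, r (c j)) * b :=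
            Finset.sum_le_sum fun c _ => mul_le_mul_of_nonneg_left (hb c) (hw c)
        _ = b := by rw [← Finset.sum_mul, hsum, one_mul]
    have hHf : ∀ v, H v ≤ f := fun v => le_min
      (ih _ (fun c => hGm _) (fun c j => by simpa using hGφ (Fin.cons v c) j.succ))
      (hHle v m fun c => hGm _)
    have hHφ : ∀ v, H v ≤ φ v := fun v => hHle v _ fun c => by simpa using hGφ (Fin.cons v c) 0
    have hfm : f ≤ m := min_le_right _ _
    -- Of the mass `L * r v`, a part `q v` is charged `φ v` and the rest `f`. If `q v ≤ L * r v` the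
    -- split is literal; if `φ v = m`, charging `m` instead of `f` only weakens the bound. After
    -- summation, each sample shrinks the excess over `e` by the factor `1 - 1 / L`.
    have key : ∀ v, L * (r v * H v) ≤ q v * φ v + (L * r v - q v) * f := by
      intro v
      rcases hφ v with h | h
      · rw [h]
        nlinarith [mul_le_mul_of_nonneg_left (hHf v) (mul_nonneg (by linarith : 0 ≤ L) (hr0 v)),
          mul_nonneg (hq0 v) (sub_nonneg.2 hfm)]
      · nlinarith [mul_le_mul_of_nonneg_left (hHφ v) (hq0 v),
          mul_le_mul_of_nonneg_left (hHf v) (sub_nonneg.2 h)]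
    have hLpos : 0 < L := by linarith
    have hsplit : ∑ c : Fin (M + 1) → V, (∏ j, r (c j)) * G c = ∑ v, r v * H v := by
      rw [← (Fin.consEquiv fun _ : Fin (M + 1) => V).sum_comp, Fintype.sum_prod_type]
      refine Finset.sum_congr rfl fun v _ => ?_
      rw [hH, Finset.mul_sum]
      refine Finset.sum_congr rfl fun c _ => ?_
      simp [Fin.consEquiv, Fin.prod_univ_succ, mul_assoc]
    have h1 : L * ∑ v, r v * H v ≤ e + (L - 1) * f := by
      have := Finset.sum_le_sum fun v (_ : v ∈ Finset.univ) => key v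
      rw [← Finset.mul_sum, Finset.sum_add_distrib, ← Finset.sum_mul, Finset.sum_sub_distrib,
        ← Finset.mul_sum, hr, hq, mul_one] at this
      exact this
    have h2 : (L - 1) * f ≤ (L - 1) * (e + m * (1 - 1 / L) ^ M) :=
      mul_le_mul_of_nonneg_left (min_le_left _ _) (by linarith)
    rw [hsplit]
    have h3 : L * (e + m * (1 - 1 / L) ^ (M + 1)) = e + (L - 1) * (e + m * (1 - 1 / L) ^ M) := by
      rw [pow_succ]; field_simp; ring
    exact le_of_mul_le_mul_left (by linarith) hLpos

/-- A family of codebooks, one for each `w : W`, together with a choice `g x` of a codeword from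
the codebook of `u x`, such that the total cost of the chosen codewords is nearly the expected
cost under `q`, while an additive cost of the codebooks is nearly its expectation. -/
lemma exists_codebook (q : 𝒳 → V → ℝ) (r : W → V → ℝ) (hq : ∀ x, q x ∈ stdSimplex ℝ V)
    (hr : ∀ w, r w ∈ stdSimplex ℝ V) (u : 𝒳 → W) (φ : 𝒳 → V → ℝ) (m : 𝒳 → ℝ) {L : ℝ}
    (hL : 1 ≤ L) (hφ0 : ∀ x v, 0 ≤ φ x v) (hφm : ∀ x v, φ x v ≤ m x)
    (hφ : ∀ x v, φ x v = m x ∨ q x v ≤ L * r (u x) v) {M : ℕ} (hM : 0 < M) (h : W → V → ℝ) :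
    ∃ (c : W → Fin M → V) (g : 𝒳 → V), (∀ x, ∃ j, g x = c (u x) j) ∧
      ∑ x, φ x (g x) + ∑ w, ∑ j, h w (c w j) ≤
        ∑ x, ∑ v, q x v * φ x v + (∑ x, m x) * (1 - 1 / L) ^ M + M * ∑ w, ∑ v, r w v * h w v := by
  have : Nonempty (Fin M) := ⟨⟨0, hM⟩⟩
  -- The encoder takes a cheapest codeword, so its cost is below that of every sample, as
  -- `cover_average` requires.
  have hsel : ∀ (x : 𝒳) (d : Fin M → V), ∃ j, ∀ i, φ x (d j) ≤ φ x (d i) := fun x d =>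
    Finite.exists_min fun j => φ x (d j)
  choose J hJ using hsel
  have hw1 : ∀ w, ∑ d : Fin M → V, ∏ j, r w (d j) = 1 := fun w =>
    sum_prod_pi_eq_one (fun _ => r w) fun _ => (hr w).2
  obtain ⟨c, hc⟩ := exists_le_of_average_le
    (fun c : W → Fin M → V => ∏ w, ∏ j, r w (c w j))
    (fun c => ∑ x, φ x (c (u x) (J x (c (u x)))) + ∑ w, ∑ j, h w (c w j))
    (fun c => Finset.prod_nonneg fun w _ => Finset.prod_nonneg fun j _ => (hr w).1 _)
    (sum_prod_pi_eq_one (fun w (d : Fin M → V) => ∏ j, r w (d j)) hw1)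
    (b := ∑ x, ∑ v, q x v * φ x v + (∑ x, m x) * (1 - 1 / L) ^ M +
      M * ∑ w, ∑ v, r w v * h w v) (by
      simp only [mul_add, Finset.sum_add_distrib]
      refine add_le_add ?_ (le_of_eq ?_)
      · simp only [Finset.mul_sum]
        rw [Finset.sum_comm, Finset.sum_mul, ← Finset.sum_add_distrib]
        refine Finset.sum_le_sum fun x _ => ?_
        rw [sum_prod_pi_mul_apply (fun w (d : Fin M → V) => ∏ j, r w (d j)) hw1 (u x)
          (fun d => φ x (d (J x d)))]
        exact cover_average (q x) (r (u x)) (φ x) (hq x).1 (hq x).2 (hr _).1 (hr _).2 hL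
          (hφ0 x) (hφ x) M (fun d => φ x (d (J x d))) (fun d => hφm _ _) (fun d j => hJ x d j)
      · simp only [Finset.mul_sum]
        rw [Finset.sum_comm]
        refine Finset.sum_congr rfl fun w _ => ?_
        rw [Finset.sum_comm]
        have : ∀ j : Fin M, ∑ c : W → Fin M → V, (∏ w, ∏ j, r w (c w j)) * h w (c w j) =
            ∑ v, r w v * h w v := by
          intro j
          rw [sum_prod_pi_mul_apply (fun w (d : Fin M → V) => ∏ j, r w (d j)) hw1 w
            (fun d => h w (d j))]
          exact sum_prod_pi_mul_apply (fun _ => r w) (fun _ => (hr w).2) j (h w)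
        simp only [this, Finset.sum_const, Finset.card_univ, Fintype.card_fin, nsmul_eq_mul,
          Finset.mul_sum])
  exact ⟨c, fun x => c (u x) (J x (c (u x))), fun x => ⟨_, rfl⟩, hc⟩

end Random

/-! ### A one-shot coding theorem -/

section OneShot

set_option linter.unusedSectionVars false

variable {S 𝒳 𝒴 V₀ V : Type*} [Fintype S] [Fintype 𝒳] [Fintype V₀] [DecidableEq V₀] [Fintype V]
  [DecidableEq V]

lemma sum_ind_eq_mul (w : V) (F : V → ℝ) : ∑ v, ind (w = v) * F v = F w := by simp [ind]

/-- Codebooks for a random source `X`, in terms of expected costs. -/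
lemma exists_source_codebook {W : Type*} [Fintype W] [DecidableEq W] (μ : S → ℝ)
    (hμ : μ ∈ stdSimplex ℝ S) (X : S → 𝒳)
    (q : 𝒳 → V → ℝ) (r : W → V → ℝ) (hq : ∀ x, q x ∈ stdSimplex ℝ V)
    (hr : ∀ w, r w ∈ stdSimplex ℝ V) (u : 𝒳 → W) (ψ : S → V → ℝ) {b L : ℝ} (hL : 1 ≤ L)
    (hψ0 : ∀ s v, 0 ≤ ψ s v) (hψb : ∀ s v, ψ s v ≤ b)
    (hψ : ∀ x v, q x v ≤ L * r (u x) v ∨ ∀ s, X s = x → ψ s v = b)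
    {M : ℕ} (hM : 0 < M) (h : W → V → ℝ) :
    ∃ (c : W → Fin M → V) (g : 𝒳 → V), (∀ x, ∃ j, g x = c (u x) j) ∧
      ∑ s, μ s * ψ s (g (X s)) + ∑ w, ∑ j, h w (c w j) ≤
        ∑ s, μ s * ∑ v, q (X s) v * ψ s v + b * (1 - 1 / L) ^ M +
          M * ∑ w, ∑ v, r w v * h w v := by
  classical
  have hfib : ∀ F : 𝒳 → S → ℝ, ∑ x, ∑ s, ind (X s = x) * F x s = ∑ s, F (X s) s := by
    intro F
    rw [Finset.sum_comm]
    exact Finset.sum_congr rfl fun s _ => sum_ind_eq_mul (X s) fun x => F x s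
  -- The encoder sees `x` but not the outcome `s`, so a codeword is charged its total cost over the
  -- fibre of `X`; the maximum is `b` times the mass of the fibre.
  obtain ⟨c, g, hg, hle⟩ := exists_codebook q r hq hr u
    (fun x v => ∑ s, ind (X s = x) * (μ s * ψ s v)) (fun x => ∑ s, ind (X s = x) * (μ s * b)) hL
    (fun x v => Finset.sum_nonneg fun s _ => mul_nonneg (ind_nonneg _)
      (mul_nonneg (hμ.1 s) (hψ0 _ _)))
    (fun x v => Finset.sum_le_sum fun s _ => mul_le_mul_of_nonneg_left
      (mul_le_mul_of_nonneg_left (hψb _ _) (hμ.1 s)) (ind_nonneg _))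
    (fun x v => (hψ x v).symm.imp_left fun hb => Finset.sum_congr rfl fun s _ => by
      by_cases hs : X s = x
      · rw [hb s hs]
      · simp [ind_false hs])
    hM h
  have e1 : ∑ x, ∑ s, ind (X s = x) * (μ s * ψ s (g x)) = ∑ s, μ s * ψ s (g (X s)) :=
    hfib fun x s => μ s * ψ s (g x)
  have e2 : ∑ x, ∑ s, ind (X s = x) * (μ s * b) = b := by
    rw [hfib fun _ s => μ s * b, ← Finset.sum_mul, hμ.2, one_mul]
  have e3 : ∑ x, ∑ v, q x v * ∑ s, ind (X s = x) * (μ s * ψ s v) =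
      ∑ s, μ s * ∑ v, q (X s) v * ψ s v := by
    rw [← hfib fun x s => μ s * ∑ v, q x v * ψ s v]
    refine Finset.sum_congr rfl fun x _ => ?_
    simp only [Finset.mul_sum]
    rw [Finset.sum_comm]
    exact Finset.sum_congr rfl fun s _ => Finset.sum_congr rfl fun v _ => by ring
  rw [e1, e2, e3] at hle
  exact ⟨c, g, hg, hle⟩

/-- Superposition layer: the common codebook `c₀` and the choice `u` are already fixed, and each
common codeword gets its own private codebook. Besides covering, the same draw must keep two
ambiguity counts small: accepted pairs over all of `c₀` (weight `A`) and accepted private codewords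
under the common codeword in use (weight `B`). -/
lemma exists_private_codebook (μ : S → ℝ) (hμ : μ ∈ stdSimplex ℝ S) (X : S → 𝒳) (Y : S → 𝒴)
    (q : 𝒳 → V₀ → V → ℝ) (hq : ∀ x w, q x w ∈ stdSimplex ℝ V)
    (r : V₀ → V → ℝ) (hr : ∀ w, r w ∈ stdSimplex ℝ V)
    (T : 𝒳 → 𝒴 → V₀ → V → Prop) (D : V₀ → V → 𝒴 → Prop) {L : ℝ} (hL : 1 ≤ L)
    (hT : ∀ x y w v, T x y w v → q x w v ≤ L * r w v) {M : ℕ} (hM : 0 < M)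
    {β : ℝ} (hβ : ∀ w y, ∑ v, r w v * ind (D w v y) ≤ β)
    {M₀ : ℕ} (c₀ : Fin M₀ → V₀) (u : 𝒳 → V₀) {A B : ℝ} (hB : 0 ≤ B) :
    ∃ (c : V₀ → Fin M → V) (g : 𝒳 → V), (∀ x, ∃ j, g x = c (u x) j) ∧
      ∑ s, μ s * ind (¬ T (X s) (Y s) (u (X s)) (g (X s))) +
        (A * ∑ s, μ s * ∑ i, ∑ j, ind (D (c₀ i) (c (c₀ i) j) (Y s)) +
          B * ∑ s, μ s * ∑ j, ind (D (u (X s)) (c (u (X s)) j) (Y s))) ≤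
      ∑ s, μ s * ∑ v, q (X s) (u (X s)) v * ind (¬ T (X s) (Y s) (u (X s)) v) +
        (1 - 1 / L) ^ M +
        M * (A * ∑ s, μ s * ∑ i, ∑ v, r (c₀ i) v * ind (D (c₀ i) v (Y s)) + B * β) := by
  -- A common codeword is charged `A` for each occurrence in `c₀` and `B` when it is in use; both
  -- counts thus become one additive cost of the codebooks.
  set k : V₀ → S → ℝ := fun w s => A * (μ s * ∑ i, ind (c₀ i = w)) +
    B * (μ s * ind (u (X s) = w)) with hk
  set h : V₀ → V → ℝ := fun w v => ∑ s, k w s * ind (D w v (Y s)) with hh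
  have hksum : ∀ G : V₀ → S → ℝ, ∑ w, ∑ s, k w s * G w s =
      A * ∑ s, μ s * ∑ i, G (c₀ i) s + B * ∑ s, μ s * G (u (X s)) s := by
    intro G
    rw [Finset.sum_comm, Finset.mul_sum, Finset.mul_sum, ← Finset.sum_add_distrib]
    refine Finset.sum_congr rfl fun s _ => ?_
    simp only [hk, add_mul, Finset.sum_add_distrib, mul_assoc]
    rw [← Finset.mul_sum, ← Finset.mul_sum, ← Finset.mul_sum, ← Finset.mul_sum, sum_ind_eq_mul]
    simp only [Finset.sum_mul]
    rw [Finset.sum_comm]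
    simp only [sum_ind_eq_mul _ fun w => G w s]
  obtain ⟨c, g, hg, hle⟩ := exists_source_codebook μ hμ X (fun x => q x (u x)) r (fun x => hq x _)
    hr u (fun s v => ind (¬ T (X s) (Y s) (u (X s)) v)) hL (fun _ _ => ind_nonneg _)
    (fun _ _ => ind_le_one _)
    (fun x v => by
      refine or_iff_not_imp_left.2 fun hx s hs => ind_true fun hc => hx ?_
      subst hs
      exact hT _ _ _ _ hc)
    hM h
  have e4 : ∑ w, ∑ j, h w (c w j) =
      A * ∑ s, μ s * ∑ i, ∑ j, ind (D (c₀ i) (c (c₀ i) j) (Y s)) +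
          B * ∑ s, μ s * ∑ j, ind (D (u (X s)) (c (u (X s)) j) (Y s)) := by
    rw [← hksum fun w s => ∑ j, ind (D w (c w j) (Y s))]
    refine Finset.sum_congr rfl fun w _ => ?_
    simp only [hh, Finset.mul_sum]
    exact Finset.sum_comm
  have e5 : ∑ w, ∑ v, r w v * h w v ≤
      A * ∑ s, μ s * ∑ i, ∑ v, r (c₀ i) v * ind (D (c₀ i) v (Y s)) + B * β := by
    have e6 : ∑ w, ∑ v, r w v * h w v =
      A * ∑ s, μ s * ∑ i, ∑ v, r (c₀ i) v * ind (D (c₀ i) v (Y s)) +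
      B * ∑ s, μ s * ∑ v, r (u (X s)) v * ind (D (u (X s)) v (Y s)) := by
      rw [← hksum fun w s => ∑ v, r w v * ind (D w v (Y s))]
      refine Finset.sum_congr rfl fun w _ => ?_
      simp only [hh, Finset.mul_sum]
      rw [Finset.sum_comm]
      exact Finset.sum_congr rfl fun s _ => Finset.sum_congr rfl fun v _ => by ring
    rw [e6]
    refine add_le_add le_rfl (mul_le_mul_of_nonneg_left ?_ hB)
    calc _ ≤ ∑ s, μ s * β :=
          Finset.sum_le_sum fun s _ => mul_le_mul_of_nonneg_left (hβ _ _) (hμ.1 s)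
      _ = β := by rw [← Finset.sum_mul, hμ.2, one_mul]
  refine ⟨c, g, hg, ?_⟩
  rw [e4, one_mul] at hle
  refine hle.trans (add_le_add le_rfl (mul_le_mul_of_nonneg_left e5 (Nat.cast_nonneg M)))


/-- Since the hash acts on pairs, a pair with another common codeword but the same private one is
also separated. If the common codeword is right, `f₀` collides automatically; if it is wrong, the
collision under the given `f₀` stays in the bound, to be averaged when `f₀` is chosen. -/
lemma exists_pair_hash {K : Type*} {B : ℕ} (hB : 0 < B) (a : S → V₀ × V) (f₀ : V₀ → K)
    (N : S → V₀ → V → ℝ) (hN : ∀ s w v, 0 ≤ N s w v) :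
    ∃ f : V₀ × V → Fin B,
      ∑ s, ∑ b : V₀ × V, N s b.1 b.2 * ind (b ≠ a s ∧ f₀ b.1 = f₀ (a s).1 ∧ f b = f (a s)) ≤
      1 / B * (∑ s, ∑ v, N s (a s).1 v +
        ∑ s, ∑ w, (∑ v, N s w v) * ind (w ≠ (a s).1 ∧ f₀ w = f₀ (a s).1)) := by
  obtain ⟨f, hf⟩ := exists_hash hB a
    (fun s b => N s b.1 b.2 * ind (f₀ b.1 = f₀ (a s).1))
    fun s b => mul_nonneg (hN _ _ _) (ind_nonneg _)
  refine ⟨f, le_trans (le_of_eq ?_) (hf.trans (mul_le_mul_of_nonneg_left ?_ (by positivity)))⟩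
  · refine Finset.sum_congr rfl fun s _ => Finset.sum_congr rfl fun b _ => ?_
    by_cases h : f₀ b.1 = f₀ (a s).1 <;> simp [ind, h]
  · rw [← Finset.sum_add_distrib]
    refine Finset.sum_le_sum fun s _ => ?_
    rw [Fintype.sum_prod_type]
    have h1 : ∑ v, N s (a s).1 v = ∑ w, ind (w = (a s).1) * ∑ v, N s w v := by simp [ind]
    rw [h1, ← Finset.sum_add_distrib]
    refine Finset.sum_le_sum fun w _ => ?_
    dsimp only
    rw [← Finset.sum_mul, mul_comm (ind _), ← mul_add]
    refine mul_le_mul_of_nonneg_left ?_ (Finset.sum_nonneg fun v _ => hN _ _ _)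
    refine le_trans (ind_mono fun h => ?_) (ind_or_le _ _)
    tauto

/-- Any candidate with the received hashes will do, because uniqueness forces it to be the true
pair. An arbitrary output covers the absence of candidates. -/
lemma exists_decoder {K₀ K : Type*} [Nonempty V] (C : V₀ → V → Prop) (D : V₀ → V → 𝒴 → Prop)
    (f₀ : V₀ → K₀) (f : V₀ × V → K) (a : 𝒳 → V₀ × V) (ha : ∀ x, C (a x).1 (a x).2) :
    ∃ dec : K₀ → K → 𝒴 → V, ∀ x y, D (a x).1 (a x).2 y →
      (∀ b, C b.1 b.2 → D b.1 b.2 y → ¬ (b ≠ a x ∧ f₀ b.1 = f₀ (a x).1 ∧ f b = f (a x))) →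
      dec (f₀ (a x).1) (f (a x)) y = (a x).2 := by
  classical
  refine ⟨fun k₀ k y => if h : ∃ b : V₀ × V, C b.1 b.2 ∧ D b.1 b.2 y ∧ f₀ b.1 = k₀ ∧ f b = k
    then h.choose.2 else Classical.arbitrary V, fun x y hD huniq => ?_⟩
  have h : ∃ b : V₀ × V, C b.1 b.2 ∧ D b.1 b.2 y ∧ f₀ b.1 = f₀ (a x).1 ∧ f b = f (a x) :=
    ⟨a x, ha x, hD, rfl, rfl⟩
  simp only [dif_pos h]
  obtain ⟨h1, h2, h3, h4⟩ := h.choose_spec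
  have := huniq _ h1 h2
  by_contra hne
  exact this ⟨fun he => hne (by rw [he]), h3, h4⟩

/-- The event that a reconstruction obtained by hashing and unique decoding is not `good`. -/
lemma exists_hash_decoder {K : Type*} [Nonempty V] (μ : S → ℝ) (hμ : ∀ s, 0 ≤ μ s) (X : S → 𝒳)
    (Y : S → 𝒴) (T : 𝒳 → 𝒴 → V₀ → V → Prop) (D : V₀ → V → 𝒴 → Prop) (good : 𝒳 → V → Prop)
    (hTD : ∀ x y w v, T x y w v → D w v y) (hTg : ∀ x y w v, T x y w v → good x v)
    (C : V₀ → V → Prop) (u : 𝒳 → V₀) (g : 𝒳 → V) (ha : ∀ x, C (u x) (g x))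
    (f₀ : V₀ → K) {B : ℕ} (hB : 0 < B) :
    ∃ (f : V₀ × V → Fin B) (dec : K → Fin B → 𝒴 → V),
      ∑ s, μ s * ind (¬ good (X s) (dec (f₀ (u (X s))) (f (u (X s), g (X s))) (Y s))) ≤
      ∑ s, μ s * ind (¬ T (X s) (Y s) (u (X s)) (g (X s))) +
      1 / B * (∑ s, μ s * ∑ v, ind (C (u (X s)) v ∧ D (u (X s)) v (Y s)) +
        ∑ s, ∑ w, (μ s * ∑ v, ind (C w v ∧ D w v (Y s))) *
          ind (w ≠ u (X s) ∧ f₀ w = f₀ (u (X s)))) := by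
  obtain ⟨f, hf⟩ := exists_pair_hash hB (fun s => (u (X s), g (X s))) f₀
    (fun s w v => μ s * ind (C w v ∧ D w v (Y s)))
    (fun s w v => mul_nonneg (hμ s) (ind_nonneg _))
  obtain ⟨dec, hdec⟩ := exists_decoder C D f₀ f (fun x => (u x, g x)) ha
  refine ⟨f, dec, ?_⟩
  simp only [← Finset.mul_sum] at hf
  refine le_trans ?_ (add_le_add le_rfl hf)
  rw [← Finset.sum_add_distrib]
  refine Finset.sum_le_sum fun s _ => ?_
  simp only [mul_assoc]
  rw [← Finset.mul_sum, ← mul_add]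
  refine mul_le_mul_of_nonneg_left ?_ (hμ s)
  have hnn : ∀ b : V₀ × V, 0 ≤ ind (C b.1 b.2 ∧ D b.1 b.2 (Y s)) *
      ind (b ≠ (u (X s), g (X s)) ∧ f₀ b.1 = f₀ (u (X s)) ∧ f b = f (u (X s), g (X s))) :=
    fun b => mul_nonneg (ind_nonneg _) (ind_nonneg _)
  -- A failed test is paid for by the first term. After a passed test, an error needs another
  -- colliding candidate, which alone contributes 1 to the sum.
  by_cases hT : T (X s) (Y s) (u (X s)) (g (X s))
  · rw [ind_false (not_not.2 hT), zero_add]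
    by_cases hb : ∃ b : V₀ × V, (C b.1 b.2 ∧ D b.1 b.2 (Y s)) ∧
        (b ≠ (u (X s), g (X s)) ∧ f₀ b.1 = f₀ (u (X s)) ∧ f b = f (u (X s), g (X s)))
    · obtain ⟨b, hb1, hb2⟩ := hb
      refine le_trans ?_ (Finset.single_le_sum (fun b _ => hnn b) (Finset.mem_univ b))
      rw [ind_true hb1, ind_true hb2, one_mul]
      exact ind_le_one _
    · rw [ind_false]
      · exact Finset.sum_nonneg fun b _ => hnn b
      · rw [not_not, hdec (X s) (Y s) (hTD _ _ _ _ hT)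
          (fun b h1 h2 h3 => hb ⟨b, ⟨h1, h2⟩, h3⟩)]
        exact hTg _ _ _ _ hT
  · rw [ind_true hT]
    exact (ind_le_one _).trans (le_add_of_nonneg_right (Finset.sum_nonneg fun b _ => hnn b))

/-- A union bound over indices: a repeated codeword counts once on the left and with multiplicity on
the right. It passes from the set of candidates to the codebook costs. -/
lemma sum_ind_range_mul_le {I : Type*} [Fintype I] (c : I → V) (G : V → ℝ) (hG : ∀ v, 0 ≤ G v) :
    ∑ v, ind (∃ i, c i = v) * G v ≤ ∑ i, G (c i) := by
  simp only [← sum_ind_eq_mul (c _) G]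
  rw [Finset.sum_comm]
  refine Finset.sum_le_sum fun v _ => ?_
  rw [← Finset.sum_mul]
  refine mul_le_mul_of_nonneg_right ?_ (hG v)
  by_cases h : ∃ i, c i = v
  · obtain ⟨i, hi⟩ := h
    refine le_trans (ind_le_one _) ?_
    rw [← ind_true hi]
    exact Finset.single_le_sum (f := fun i => ind (c i = v)) (fun _ _ => ind_nonneg _)
      (Finset.mem_univ i)
  · rw [ind_false h]
    exact Finset.sum_nonneg fun _ _ => ind_nonneg _

lemma sum_codebook_le {I J : Type*} [Fintype I] [Fintype J] (c₀ : I → V₀) (c : V₀ → J → V)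
    (P : V₀ → V → Prop) :
    ∑ w, ∑ v, ind (((∃ i, c₀ i = w) ∧ ∃ j, c w j = v) ∧ P w v) ≤
      ∑ i, ∑ j, ind (P (c₀ i) (c (c₀ i) j)) := by
  refine le_trans (Finset.sum_le_sum fun w _ => ?_) (sum_ind_range_mul_le c₀
    (fun w => ∑ j, ind (P w (c w j))) fun w => Finset.sum_nonneg fun _ _ => ind_nonneg _)
  simp only [ind_and, mul_assoc]
  rw [← Finset.mul_sum]
  exact mul_le_mul_of_nonneg_left (sum_ind_range_mul_le (c w) (fun v => ind (P w v))
    fun _ => ind_nonneg _) (ind_nonneg _)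

lemma sum_codebook_fiber_le {I J : Type*} [Fintype J] (c₀ : I → V₀) (c : V₀ → J → V)
    (w : V₀) (P : V → Prop) :
    ∑ v, ind (((∃ i, c₀ i = w) ∧ ∃ j, c w j = v) ∧ P v) ≤ ∑ j, ind (P (c w j)) := by
  refine le_trans (Finset.sum_le_sum fun v _ => ?_) (sum_ind_range_mul_le (c w)
    (fun v => ind (P v)) fun _ => ind_nonneg _)
  rw [← ind_and]
  exact ind_mono fun h => ⟨h.1.2, h.2⟩

end OneShot

/-- One-shot achievability for two receivers. Codewords for `V₀` are drawn from `r₀`, codewords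
for `Vᵢ` from `rᵢ`; the encoder tries to satisfy `Tᵢ`, and receiver `i` decodes within `Dᵢ`. -/
theorem one_shot {S 𝒳 𝒴₁ 𝒴₂ V₀ V₁ V₂ : Type*} [Fintype S] [Fintype 𝒳] [Fintype V₀] [Fintype V₁]
    [Fintype V₂] [Nonempty V₁] [Nonempty V₂]
    (μ : S → ℝ) (hμ : μ ∈ stdSimplex ℝ S) (X : S → 𝒳) (Y₁ : S → 𝒴₁) (Y₂ : S → 𝒴₂)
    (q₀ : 𝒳 → V₀ → ℝ) (hq₀ : ∀ x, q₀ x ∈ stdSimplex ℝ V₀)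
    (r₀ : V₀ → ℝ) (hr₀ : r₀ ∈ stdSimplex ℝ V₀)
    (q₁ : 𝒳 → V₀ → V₁ → ℝ) (hq₁ : ∀ x w, q₁ x w ∈ stdSimplex ℝ V₁)
    (r₁ : V₀ → V₁ → ℝ) (hr₁ : ∀ w, r₁ w ∈ stdSimplex ℝ V₁)
    (q₂ : 𝒳 → V₀ → V₂ → ℝ) (hq₂ : ∀ x w, q₂ x w ∈ stdSimplex ℝ V₂)
    (r₂ : V₀ → V₂ → ℝ) (hr₂ : ∀ w, r₂ w ∈ stdSimplex ℝ V₂)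
    (T₁ : 𝒳 → 𝒴₁ → V₀ → V₁ → Prop) (D₁ : V₀ → V₁ → 𝒴₁ → Prop) (good₁ : 𝒳 → V₁ → Prop)
    (T₂ : 𝒳 → 𝒴₂ → V₀ → V₂ → Prop) (D₂ : V₀ → V₂ → 𝒴₂ → Prop) (good₂ : 𝒳 → V₂ → Prop)
    {L₀ L₁ L₂ α₁ α₂ β₁ β₂ : ℝ} (hL₀ : 1 ≤ L₀) (hL₁ : 1 ≤ L₁) (hL₂ : 1 ≤ L₂)
    (hTq₁₀ : ∀ x y w v, T₁ x y w v → q₀ x w ≤ L₀ * r₀ w)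
    (hTq₂₀ : ∀ x y w v, T₂ x y w v → q₀ x w ≤ L₀ * r₀ w)
    (hTq₁ : ∀ x y w v, T₁ x y w v → q₁ x w v ≤ L₁ * r₁ w v)
    (hTq₂ : ∀ x y w v, T₂ x y w v → q₂ x w v ≤ L₂ * r₂ w v)
    (hTD₁ : ∀ x y w v, T₁ x y w v → D₁ w v y) (hTg₁ : ∀ x y w v, T₁ x y w v → good₁ x v)
    (hTD₂ : ∀ x y w v, T₂ x y w v → D₂ w v y) (hTg₂ : ∀ x y w v, T₂ x y w v → good₂ x v)
    (hα₁ : ∀ y, ∑ w, r₀ w * ∑ v, r₁ w v * ind (D₁ w v y) ≤ α₁)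
    (hα₂ : ∀ y, ∑ w, r₀ w * ∑ v, r₂ w v * ind (D₂ w v y) ≤ α₂)
    (hβ₁ : ∀ w y, ∑ v, r₁ w v * ind (D₁ w v y) ≤ β₁)
    (hβ₂ : ∀ w y, ∑ v, r₂ w v * ind (D₂ w v y) ≤ β₂)
    {M₀ M₁ M₂ B₀ B₁ B₂ : ℕ} (hM₀ : 0 < M₀) (hM₁ : 0 < M₁) (hM₂ : 0 < M₂)
    (hB₀ : 0 < B₀) (hB₁ : 0 < B₁) (hB₂ : 0 < B₂) :
    ∃ (enc : 𝒳 → Fin B₀ × Fin B₁ × Fin B₂) (dec₁ : Fin B₀ → Fin B₁ → 𝒴₁ → V₁)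
      (dec₂ : Fin B₀ → Fin B₂ → 𝒴₂ → V₂),
      ∑ s, μ s * ind (¬ good₁ (X s) (dec₁ (enc (X s)).1 (enc (X s)).2.1 (Y₁ s))) +
      ∑ s, μ s * ind (¬ good₂ (X s) (dec₂ (enc (X s)).1 (enc (X s)).2.2 (Y₂ s))) ≤
      ∑ s, μ s * ∑ w, q₀ (X s) w * (∑ v, q₁ (X s) w v * ind (¬ T₁ (X s) (Y₁ s) w v)) +
      ∑ s, μ s * ∑ w, q₀ (X s) w * (∑ v, q₂ (X s) w v * ind (¬ T₂ (X s) (Y₂ s) w v)) +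
      (2 * (1 - 1 / L₀) ^ M₀ + (1 - 1 / L₁) ^ M₁ + (1 - 1 / L₂) ^ M₂) +
      (M₀ * M₁ * α₁ / (B₀ * B₁) + M₁ * β₁ / B₁ + M₀ * M₂ * α₂ / (B₀ * B₂) + M₂ * β₂ / B₂) := by
  classical
  have hB₀' : (0 : ℝ) < B₀ := by exact_mod_cast hB₀
  have hB₁' : (0 : ℝ) < B₁ := by exact_mod_cast hB₁
  have hB₂' : (0 : ℝ) < B₂ := by exact_mod_cast hB₂
  -- The random choices are fixed in the order common codebook, private codebooks, common hash,
  -- private hashes. Each choice must control what later ones will pay, so the costs here are the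
  -- expected test failures of the private codewords and the expected number of confusable pairs.
  obtain ⟨c', u, hu, hc₀⟩ := exists_source_codebook (W := Unit) μ hμ X q₀ (fun _ => r₀) hq₀
    (fun _ => hr₀) (fun _ => ())
    (fun s w => ∑ v, q₁ (X s) w v * ind (¬ T₁ (X s) (Y₁ s) w v) +
      ∑ v, q₂ (X s) w v * ind (¬ T₂ (X s) (Y₂ s) w v)) (b := 2) hL₀
    (fun s w => add_nonneg (sum_mul_ind_nonneg (hq₁ _ _) _) (sum_mul_ind_nonneg (hq₂ _ _) _))
    (fun s w => by
      linarith [sum_mul_ind_le_one (hq₁ (X s) w) (fun v => ¬ T₁ (X s) (Y₁ s) w v),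
        sum_mul_ind_le_one (hq₂ (X s) w) (fun v => ¬ T₂ (X s) (Y₂ s) w v)])
    (fun x w => by
      -- Where `q₀ x w ≤ L₀ * r₀ w` fails, both tests fail for every private codeword, so the cost
      -- is at its maximum 2, one for each receiver.
      refine or_iff_not_imp_left.2 fun hx s hs => ?_
      subst hs
      rw [sum_mul_ind_eq_one (hq₁ _ _) fun v hc => hx (hTq₁₀ _ _ _ _ hc),
        sum_mul_ind_eq_one (hq₂ _ _) fun v hc => hx (hTq₂₀ _ _ _ _ hc)]
      norm_num)
    hM₀
    (fun _ w => M₁ * (1 / B₀ * (1 / B₁) * ∑ s, μ s * ∑ v, r₁ w v * ind (D₁ w v (Y₁ s))) +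
      M₂ * (1 / B₀ * (1 / B₂) * ∑ s, μ s * ∑ v, r₂ w v * ind (D₂ w v (Y₂ s))))
  set c₀ : Fin M₀ → V₀ := c' ()
  obtain ⟨c₁, g₁, hg₁, hc₁⟩ := exists_private_codebook μ hμ X Y₁ q₁ hq₁ r₁ hr₁ T₁ D₁ hL₁ hTq₁ hM₁
    hβ₁ c₀ u (A := 1 / B₀ * (1 / B₁)) (B := 1 / B₁) (by positivity)
  obtain ⟨c₂, g₂, hg₂, hc₂⟩ := exists_private_codebook μ hμ X Y₂ q₂ hq₂ r₂ hr₂ T₂ D₂ hL₂ hTq₂ hM₂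
    hβ₂ c₀ u (A := 1 / B₀ * (1 / B₂)) (B := 1 / B₂) (by positivity)
  set C₁ : V₀ → V₁ → Prop := fun w v => (∃ i, c₀ i = w) ∧ ∃ j, c₁ w j = v with hC₁
  set C₂ : V₀ → V₂ → Prop := fun w v => (∃ i, c₀ i = w) ∧ ∃ j, c₂ w j = v with hC₂
  have ha₁ : ∀ x, C₁ (u x) (g₁ x) := fun x =>
    ⟨(hu x).imp fun _ h => h.symm, (hg₁ x).imp fun _ h => h.symm⟩
  have ha₂ : ∀ x, C₂ (u x) (g₂ x) := fun x =>
    ⟨(hu x).imp fun _ h => h.symm, (hg₂ x).imp fun _ h => h.symm⟩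
  -- One common hash must serve both receivers, so their confusable weights form one cost, already
  -- scaled by the factors that the private hashes will contribute.
  obtain ⟨f₀, hf₀⟩ := exists_hash hB₀ (fun s => u (X s))
    (fun s w => 1 / B₁ * (μ s * ∑ v, ind (C₁ w v ∧ D₁ w v (Y₁ s))) +
      1 / B₂ * (μ s * ∑ v, ind (C₂ w v ∧ D₂ w v (Y₂ s))))
    (fun s w => add_nonneg
      (mul_nonneg (by positivity) (mul_nonneg (hμ.1 s) (Finset.sum_nonneg fun _ _ => ind_nonneg _)))
      (mul_nonneg (by positivity)
        (mul_nonneg (hμ.1 s) (Finset.sum_nonneg fun _ _ => ind_nonneg _))))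
  obtain ⟨f₁, dec₁, h₁⟩ := exists_hash_decoder μ hμ.1 X Y₁ T₁ D₁ good₁ hTD₁ hTg₁ C₁ u g₁ ha₁ f₀ hB₁
  obtain ⟨f₂, dec₂, h₂⟩ := exists_hash_decoder μ hμ.1 X Y₂ T₂ D₂ good₂ hTD₂ hTg₂ C₂ u g₂ ha₂ f₀ hB₂
  refine ⟨fun x => (f₀ (u x), f₁ (u x, g₁ x), f₂ (u x, g₂ x)), dec₁, dec₂, ?_⟩
  refine (add_le_add h₁ h₂).trans ?_
  simp only [add_mul, mul_add, Finset.sum_add_distrib, mul_assoc, ← Finset.mul_sum,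
    Finset.univ_unique, Finset.sum_singleton] at hf₀ hc₀ hc₁ hc₂ ⊢
  have p₁ : ∑ s, μ s * ∑ v, ind (C₁ (u (X s)) v ∧ D₁ (u (X s)) v (Y₁ s)) ≤
      ∑ s, μ s * ∑ j, ind (D₁ (u (X s)) (c₁ (u (X s)) j) (Y₁ s)) :=
    Finset.sum_le_sum fun s _ => mul_le_mul_of_nonneg_left
      (sum_codebook_fiber_le c₀ c₁ _ _) (hμ.1 s)
  have p₂ : ∑ s, μ s * ∑ v, ind (C₂ (u (X s)) v ∧ D₂ (u (X s)) v (Y₂ s)) ≤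
      ∑ s, μ s * ∑ j, ind (D₂ (u (X s)) (c₂ (u (X s)) j) (Y₂ s)) :=
    Finset.sum_le_sum fun s _ => mul_le_mul_of_nonneg_left
      (sum_codebook_fiber_le c₀ c₂ _ _) (hμ.1 s)
  have n₁ : ∑ s, μ s * ∑ w, ∑ v, ind (C₁ w v ∧ D₁ w v (Y₁ s)) ≤
      ∑ s, μ s * ∑ i, ∑ j, ind (D₁ (c₀ i) (c₁ (c₀ i) j) (Y₁ s)) :=
    Finset.sum_le_sum fun s _ => mul_le_mul_of_nonneg_left
      (sum_codebook_le c₀ c₁ fun w v => D₁ w v (Y₁ s)) (hμ.1 s)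
  have n₂ : ∑ s, μ s * ∑ w, ∑ v, ind (C₂ w v ∧ D₂ w v (Y₂ s)) ≤
      ∑ s, μ s * ∑ i, ∑ j, ind (D₂ (c₀ i) (c₂ (c₀ i) j) (Y₂ s)) :=
    Finset.sum_le_sum fun s _ => mul_le_mul_of_nonneg_left
      (sum_codebook_le c₀ c₂ fun w v => D₂ w v (Y₂ s)) (hμ.1 s)
  have hc' : ∀ i, c' default i = c₀ i := fun _ => rfl
  have e₁ : ∑ i, ∑ s, μ s * ∑ v, r₁ (c' default i) v * ind (D₁ (c' default i) v (Y₁ s)) =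
      ∑ s, μ s * ∑ i, ∑ v, r₁ (c₀ i) v * ind (D₁ (c₀ i) v (Y₁ s)) := by
    simp only [hc']
    rw [Finset.sum_comm]
    simp only [Finset.mul_sum]
  have e₂ : ∑ i, ∑ s, μ s * ∑ v, r₂ (c' default i) v * ind (D₂ (c' default i) v (Y₂ s)) =
      ∑ s, μ s * ∑ i, ∑ v, r₂ (c₀ i) v * ind (D₂ (c₀ i) v (Y₂ s)) := by
    simp only [hc']
    rw [Finset.sum_comm]
    simp only [Finset.mul_sum]
  rw [e₁, e₂] at hc₀
  have hα : ∀ (K α : ℝ) (F : S → V₀ → ℝ), 0 ≤ K → (∀ s, ∑ w, r₀ w * F s w ≤ α) →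
      ∑ w, r₀ w * (K * ∑ s, μ s * F s w) ≤ K * α := by
    intro K α F hK hF
    have h1 : ∑ w, r₀ w * (K * ∑ s, μ s * F s w) = K * ∑ s, μ s * ∑ w, r₀ w * F s w := by
      simp only [Finset.mul_sum]
      rw [Finset.sum_comm]
      exact Finset.sum_congr rfl fun s _ => Finset.sum_congr rfl fun w _ => by ring
    rw [h1]
    refine mul_le_mul_of_nonneg_left ?_ hK
    calc _ ≤ ∑ s, μ s * α :=
          Finset.sum_le_sum fun s _ => mul_le_mul_of_nonneg_left (hF s) (hμ.1 s)
      _ = α := by rw [← Finset.sum_mul, hμ.2, one_mul]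
  have t₁ := mul_le_mul_of_nonneg_left (hα (M₁ * (1 / B₀ * (1 / B₁))) α₁
    (fun s w => ∑ v, r₁ w v * ind (D₁ w v (Y₁ s))) (by positivity) fun s => hα₁ _)
    (Nat.cast_nonneg (α := ℝ) M₀)
  have t₂ := mul_le_mul_of_nonneg_left (hα (M₂ * (1 / B₀ * (1 / B₂))) α₂
    (fun s w => ∑ v, r₂ w v * ind (D₂ w v (Y₂ s))) (by positivity) fun s => hα₂ _)
    (Nat.cast_nonneg (α := ℝ) M₀)
  simp only [mul_assoc] at t₁ t₂
  have p₁' := mul_le_mul_of_nonneg_left p₁ (by positivity : (0 : ℝ) ≤ 1 / B₁)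
  have p₂' := mul_le_mul_of_nonneg_left p₂ (by positivity : (0 : ℝ) ≤ 1 / B₂)
  have n₁' := mul_le_mul_of_nonneg_left n₁ (by positivity : (0 : ℝ) ≤ 1 / B₀ * (1 / B₁))
  have n₂' := mul_le_mul_of_nonneg_left n₂ (by positivity : (0 : ℝ) ≤ 1 / B₀ * (1 / B₂))
  simp only [mul_assoc] at n₁' n₂'
  have d₁ : (M₀ : ℝ) * (M₁ * α₁) / (B₀ * B₁) = M₀ * (M₁ * (1 / B₀ * (1 / B₁ * α₁))) := by
    field_simp
  have d₂ : (M₀ : ℝ) * (M₂ * α₂) / (B₀ * B₂) = M₀ * (M₂ * (1 / B₀ * (1 / B₂ * α₂))) := by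
    field_simp
  have d₃ : (M₁ : ℝ) * β₁ / B₁ = M₁ * (1 / B₁ * β₁) := by field_simp
  have d₄ : (M₂ : ℝ) * β₂ / B₂ = M₂ * (1 / B₂ * β₂) := by field_simp
  rw [d₁, d₂, d₃, d₄]
  linarith

/-! ### The weak law of large numbers for finite alphabets -/

section WeakLaw

variable {A B : Type*} [Fintype A] [Fintype B]

/-- The probability of the event `E` for `n` independent copies of `J`. -/
noncomputable def iidProb (J : A → ℝ) (n : ℕ) (E : (Fin n → A) → Prop) : ℝ :=
  ∑ u, iidLaw J n u * ind (E u)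

lemma iidLaw_mem_stdSimplex {J : A → ℝ} (hJ : J ∈ stdSimplex ℝ A) (n : ℕ) :
    iidLaw J n ∈ stdSimplex ℝ (Fin n → A) :=
  ⟨fun _ => Finset.prod_nonneg fun _ _ => hJ.1 _,
    sum_prod_pi_eq_one (fun _ => J) fun _ => hJ.2⟩

lemma iidProb_nonneg {J : A → ℝ} (hJ : J ∈ stdSimplex ℝ A) (n : ℕ) (E : (Fin n → A) → Prop) :
    0 ≤ iidProb J n E :=
  Finset.sum_nonneg fun _ _ => mul_nonneg ((iidLaw_mem_stdSimplex hJ n).1 _) (ind_nonneg _)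

/-- Sequences with a letter of probability zero have no weight, so the implication is needed on the
support only; there the likelihood ratios are quotients of positive numbers. -/
lemma iidProb_mono {J : A → ℝ} (hJ : J ∈ stdSimplex ℝ A) {n : ℕ} {E F : (Fin n → A) → Prop}
    (h : ∀ u, (∀ t, 0 < J (u t)) → E u → F u) : iidProb J n E ≤ iidProb J n F := by
  refine Finset.sum_le_sum fun u _ => ?_
  by_cases hu : ∀ t, 0 < J (u t)
  · exact mul_le_mul_of_nonneg_left (ind_mono (h u hu)) ((iidLaw_mem_stdSimplex hJ n).1 _)
  · push Not at hu
    obtain ⟨t, ht⟩ := hu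
    have : iidLaw J n u = 0 :=
      Finset.prod_eq_zero (Finset.mem_univ t) (le_antisymm ht (hJ.1 _))
    simp [this]

lemma iidProb_or_le {J : A → ℝ} (hJ : J ∈ stdSimplex ℝ A) (n : ℕ) (E F : (Fin n → A) → Prop) :
    iidProb J n (fun u => E u ∨ F u) ≤ iidProb J n E + iidProb J n F := by
  unfold iidProb
  rw [← Finset.sum_add_distrib]
  refine Finset.sum_le_sum fun u _ => ?_
  rw [← mul_add]
  exact mul_le_mul_of_nonneg_left (ind_or_le _ _) ((iidLaw_mem_stdSimplex hJ n).1 _)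

lemma iidProb_exists_le {J : A → ℝ} (hJ : J ∈ stdSimplex ℝ A) (n : ℕ)
    (E : B → (Fin n → A) → Prop) :
    iidProb J n (fun u => ∃ b, E b u) ≤ ∑ b, iidProb J n (E b) := by
  unfold iidProb
  rw [Finset.sum_comm]
  refine Finset.sum_le_sum fun u _ => ?_
  rw [← Finset.mul_sum]
  refine mul_le_mul_of_nonneg_left ?_ ((iidLaw_mem_stdSimplex hJ n).1 _)
  by_cases h : ∃ b, E b u
  · obtain ⟨b, hb⟩ := h
    refine le_trans (ind_le_one _) ?_
    rw [← ind_true hb]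
    exact Finset.single_le_sum (f := fun b => ind (E b u)) (fun _ _ => ind_nonneg _)
      (Finset.mem_univ b)
  · rw [ind_false h]
    exact Finset.sum_nonneg fun _ _ => ind_nonneg _

/-- The cross terms vanish: distinct coordinates are independent and `g` is centred. -/
lemma iid_variance {J : A → ℝ} (hJ : J ∈ stdSimplex ℝ A) (n : ℕ) (g : A → ℝ)
    (hg : ∑ a, J a * g a = 0) :
    ∑ u, iidLaw J n u * (∑ t, g (u t)) ^ 2 = n * ∑ a, J a * g a ^ 2 := by
  have h1 : ∀ s t : Fin n, ∑ u : Fin n → A, iidLaw J n u * (g (u s) * g (u t)) =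
      if s = t then ∑ a, J a * g a ^ 2 else 0 := by
    intro s t
    split_ifs with h
    · subst h
      simp only [← pow_two]
      exact sum_prod_pi_mul_apply (fun _ => J) (fun _ => hJ.2) s fun a => g a ^ 2
    · refine (sum_prod_pi_mul_apply_mul_apply (fun _ => J) (fun _ => hJ.2) h g g).trans ?_
      rw [hg, zero_mul]
  calc ∑ u, iidLaw J n u * (∑ t, g (u t)) ^ 2
      = ∑ u : Fin n → A, ∑ s, ∑ t, iidLaw J n u * (g (u s) * g (u t)) :=
        Finset.sum_congr rfl fun u _ => by rw [pow_two, Finset.sum_mul_sum]; simp [Finset.mul_sum]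
    _ = ∑ s : Fin n, ∑ t, ∑ u : Fin n → A, iidLaw J n u * (g (u s) * g (u t)) := by
        rw [Finset.sum_comm]
        exact Finset.sum_congr rfl fun s _ => Finset.sum_comm
    _ = n * ∑ a, J a * g a ^ 2 := by simp [h1]

/-- Chebyshev's weak law of large numbers. -/
lemma tendsto_iidProb_deviation {J : A → ℝ} (hJ : J ∈ stdSimplex ℝ A) (g : A → ℝ) {δ : ℝ}
    (hδ : 0 < δ) :
    Tendsto (fun n : ℕ => iidProb J n fun u =>
      ¬ |∑ t, g (u t) - n * ∑ a, J a * g a| ≤ n * δ) atTop (𝓝 0) := by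
  set m := ∑ a, J a * g a with hm
  set V := ∑ a, J a * (g a - m) ^ 2 with hV
  have hz : ∑ a, J a * (g a - m) = 0 := by
    simp [mul_sub, Finset.sum_sub_distrib, ← Finset.sum_mul, hJ.2, ← hm]
  have hlim : Tendsto (fun n : ℕ => V / δ ^ 2 / n) atTop (𝓝 0) :=
    tendsto_const_div_atTop_nhds_zero_nat _
  refine squeeze_zero' (Eventually.of_forall fun n => iidProb_nonneg hJ n _) ?_ hlim
  filter_upwards [eventually_gt_atTop 0] with n hn
  have hn' : (0 : ℝ) < n := by exact_mod_cast hn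
  have h1 : ∀ u : Fin n → A, ind (¬ |∑ t, g (u t) - n * m| ≤ n * δ) ≤
      (∑ t, (g (u t) - m)) ^ 2 / (n * δ) ^ 2 := by
    intro u
    have hs : ∑ t, (g (u t) - m) = ∑ t, g (u t) - n * m := by
      simp [Finset.sum_sub_distrib]
    rw [hs]
    by_cases h : |∑ t, g (u t) - n * m| ≤ n * δ
    · rw [ind_false (not_not.2 h)]; positivity
    · rw [ind_true h, le_div_iff₀ (by positivity), one_mul, ← sq_abs (_ - _)]
      exact pow_le_pow_left₀ (by positivity) (not_le.1 h).le 2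
  calc iidProb J n _ ≤ ∑ u, iidLaw J n u * ((∑ t, (g (u t) - m)) ^ 2 / (n * δ) ^ 2) :=
        Finset.sum_le_sum fun u _ => mul_le_mul_of_nonneg_left (h1 u)
          ((iidLaw_mem_stdSimplex hJ n).1 _)
    _ = (∑ u, iidLaw J n u * (∑ t, (g (u t) - m)) ^ 2) / (n * δ) ^ 2 := by
        rw [Finset.sum_div]; exact Finset.sum_congr rfl fun u _ => by ring
    _ = V / δ ^ 2 / n := by
        rw [iid_variance hJ n (fun a => g a - m) hz, ← hV]; field_simp

/-- A likelihood ratio exceeds its typical exponential size with vanishing probability. -/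
lemma tendsto_iidProb_ratio {J : A → ℝ} (hJ : J ∈ stdSimplex ℝ A) (f g : A → ℝ)
    (hf : ∀ a, 0 < J a → 0 < f a) (hg : ∀ a, 0 < J a → 0 < g a) {K : ℝ}
    (hK : ∑ a, J a * Real.logb 2 (f a / g a) = K) {δ : ℝ} (hδ : 0 < δ) :
    Tendsto (fun n : ℕ => iidProb J n fun u =>
      ¬ ∏ t, f (u t) ≤ (2 : ℝ) ^ ((n : ℝ) * (K + δ)) * ∏ t, g (u t)) atTop (𝓝 0) := by
  refine squeeze_zero (fun n => iidProb_nonneg hJ n _) (fun n => ?_)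
    (tendsto_iidProb_deviation hJ (fun a => Real.logb 2 (f a / g a)) hδ)
  refine iidProb_mono hJ fun u hu => mt fun h => ?_
  rw [hK] at h
  have hprod : ∏ t, f (u t) =
      (2 : ℝ) ^ (∑ t, Real.logb 2 (f (u t) / g (u t))) * ∏ t, g (u t) := by
    rw [Real.rpow_sum_of_pos (by norm_num), ← Finset.prod_mul_distrib]
    refine Finset.prod_congr rfl fun t _ => ?_
    rw [Real.rpow_logb (by norm_num) (by norm_num) (div_pos (hf _ (hu t)) (hg _ (hu t))),
      div_mul_cancel₀ _ (hg _ (hu t)).ne']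
  rw [hprod]
  refine mul_le_mul_of_nonneg_right ?_ (Finset.prod_nonneg fun t _ => (hg _ (hu t)).le)
  refine Real.rpow_le_rpow_of_exponent_le (by norm_num) ?_
  have := (abs_le.1 h).2
  linarith

/-- A letter with `p y = 0` has tolerance zero but never occurs in a sequence over the support. For
the other letters the weak law applies with deviation `ε * p y`, and a union bound over the finite
alphabet finishes. -/
lemma tendsto_iidProb_not_typical {J : A → ℝ} (hJ : J ∈ stdSimplex ℝ A) (b : A → B) (p : B → ℝ)
    (hp : ∀ y, ∑ a, J a * ind (b a = y) = p y) {ε : ℝ} (hε : 0 < ε) :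
    Tendsto (fun n : ℕ => iidProb J n fun u => (fun t => b (u t)) ∉ typicalSet n ε p)
      atTop (𝓝 0) := by
  have hlim : Tendsto (fun n : ℕ => ∑ y, iidProb J n fun u =>
      ¬ |relFreq (fun t => b (u t)) y - p y| ≤ ε * p y) atTop (𝓝 0) := by
    rw [← Finset.sum_const_zero (s := (Finset.univ : Finset B))]
    refine tendsto_finsetSum _ fun y _ => ?_
    have hp0 : 0 ≤ p y := by
      rw [← hp]; exact Finset.sum_nonneg fun a _ => mul_nonneg (hJ.1 a) (ind_nonneg _)
    have hfreq : ∀ (n : ℕ) (u : Fin n → A),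
        relFreq (fun t => b (u t)) y = (∑ t, ind (b (u t) = y)) / n := by
      intro n u; simp [relFreq, ind]
    rcases hp0.eq_or_lt with h0 | hpos
    · refine squeeze_zero (fun n => iidProb_nonneg hJ n _) (fun n => ?_) tendsto_const_nhds
      refine le_trans (iidProb_mono (F := fun _ => False) hJ fun u hu => ?_) (le_of_eq ?_)
      · rw [hfreq, ← h0]
        have hz : ∀ t, ind (b (u t) = y) = 0 := by
          intro t
          have h1 := hp y
          rw [← h0, Finset.sum_eq_zero_iff_of_nonneg
            fun a _ => mul_nonneg (hJ.1 a) (ind_nonneg _)] at h1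
          exact (mul_eq_zero.1 (h1 (u t) (Finset.mem_univ _))).resolve_left (hu t).ne'
        simp [hz]
      · simp [iidProb, ind]
    · refine squeeze_zero' (Eventually.of_forall fun n => iidProb_nonneg hJ n _) ?_
        (tendsto_iidProb_deviation hJ (fun a => ind (b a = y)) (mul_pos hε hpos))
      filter_upwards [eventually_gt_atTop 0] with n hn
      have hn' : (0 : ℝ) < n := by exact_mod_cast hn
      refine iidProb_mono hJ fun u _ => mt fun h => ?_
      rw [hp] at h
      rw [hfreq, show (∑ t, ind (b (u t) = y)) / (n : ℝ) - p y =
        (∑ t, ind (b (u t) = y) - n * p y) / n by field_simp, abs_div, abs_of_pos hn',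
        div_le_iff₀ hn']
      linarith
  refine squeeze_zero (fun n => iidProb_nonneg hJ n _) (fun n => ?_) hlim
  refine le_trans (iidProb_mono hJ fun u _ h => ?_) (iidProb_exists_le hJ n
    fun y u => ¬ |relFreq (fun t => b (u t)) y - p y| ≤ ε * p y)
  simpa [typicalSet] using h

end WeakLaw

/-! ### The block coding scheme for a pair of receivers -/

lemma prob_eq_sum {Ω : Type*} [Fintype Ω] (p : Ω → ℝ) (E : Set Ω) :
    prob p E = ∑ ω, p ω * ind (ω ∈ E) := by
  unfold prob ind
  exact Finset.sum_congr rfl fun ω _ => by split_ifs <;> simp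

/-- The conditional laws that govern the coding scheme for one receiver: `q x w v` is the target
law of the codeword `v` given the source `x` and the common codeword `w`, the private codebook is
drawn from `r w`, and `s y`, `t w y` are the posterior laws used for decoding. -/
structure ReceiverKernel (𝒳 𝒴 𝒱₀ 𝒱 : Type*) [Fintype 𝒱₀] [Fintype 𝒱] where
  q : 𝒳 → 𝒱₀ → 𝒱 → ℝ
  r : 𝒱₀ → 𝒱 → ℝ
  s : 𝒴 → 𝒱₀ → 𝒱 → ℝ
  t : 𝒱₀ → 𝒴 → 𝒱 → ℝ
  q_mem : ∀ x w, q x w ∈ stdSimplex ℝ 𝒱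
  r_mem : ∀ w, r w ∈ stdSimplex ℝ 𝒱
  s_nonneg : ∀ y w v, 0 ≤ s y w v
  s_sum : ∀ y, ∑ w, ∑ v, s y w v = 1
  t_mem : ∀ w y, t w y ∈ stdSimplex ℝ 𝒱

namespace ReceiverKernel

section

variable {𝒳 𝒴 𝒱₀ 𝒱 : Type*} [Fintype 𝒱₀] [Fintype 𝒱] (K : ReceiverKernel 𝒳 𝒴 𝒱₀ 𝒱)

/-- The decoding test. -/
def Dec (r₀ : 𝒱₀ → ℝ) (α β : ℝ) (w : 𝒱₀) (v : 𝒱) (y : 𝒴) : Prop :=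
  r₀ w * K.r w v ≤ α * K.s y w v ∧ K.r w v ≤ β * K.t w y v

/-- The encoding test, which subsumes the decoding test. -/
def Test (q₀ : 𝒳 → 𝒱₀ → ℝ) (r₀ : 𝒱₀ → ℝ) (L₀ L α β : ℝ) (good : 𝒳 → 𝒱 → Prop)
    (x : 𝒳) (y : 𝒴) (w : 𝒱₀) (v : 𝒱) : Prop :=
  q₀ x w ≤ L₀ * r₀ w ∧ K.q x w v ≤ L * K.r w v ∧ K.Dec r₀ α β w v y ∧ good x v

/-- Change of measure: on acceptance `r₀ w * K.r w v` is at most `α` times the posterior `K.s y w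
v`, which has total mass one. So a freshly drawn pair is accepted with probability at most `α`,
whatever `y` is. -/
lemma sum_dec_le {r₀ : 𝒱₀ → ℝ} {α β : ℝ} (hα : 0 ≤ α) (y : 𝒴) :
    ∑ w, r₀ w * ∑ v, K.r w v * ind (K.Dec r₀ α β w v y) ≤ α := by
  calc _ ≤ ∑ w, ∑ v, α * K.s y w v := by
        refine Finset.sum_le_sum fun w _ => ?_
        rw [Finset.mul_sum]
        refine Finset.sum_le_sum fun v _ => ?_
        by_cases h : K.Dec r₀ α β w v y
        · rw [ind_true h, mul_one]; exact h.1
        · rw [ind_false h]; simpa using mul_nonneg hα (K.s_nonneg _ _ _)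
    _ = α := by simp only [← Finset.mul_sum, K.s_sum, mul_one]

/-- The same change of measure with the posterior `K.t`, for a private codeword drawn under a fixed
common one. -/
lemma sum_dec_fiber_le {r₀ : 𝒱₀ → ℝ} {α β : ℝ} (hβ : 0 ≤ β) (w : 𝒱₀) (y : 𝒴) :
    ∑ v, K.r w v * ind (K.Dec r₀ α β w v y) ≤ β := by
  calc _ ≤ ∑ v, β * K.t w y v := by
        refine Finset.sum_le_sum fun v _ => ?_
        by_cases h : K.Dec r₀ α β w v y
        · rw [ind_true h, mul_one]; exact h.2
        · rw [ind_false h]; simpa using mul_nonneg hβ ((K.t_mem _ _).1 _)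
    _ = β := by rw [← Finset.mul_sum, (K.t_mem _ _).2, mul_one]

end

variable {𝒳 𝒴 𝒱₀ 𝒱 : Type*} [Fintype 𝒱₀] [Fintype 𝒱]

lemma pow_mem_stdSimplex {A : Type*} [Fintype A] {n : ℕ} {f : Fin n → A → ℝ}
    (hf : ∀ t, f t ∈ stdSimplex ℝ A) : (fun a : Fin n → A => ∏ t, f t (a t)) ∈
      stdSimplex ℝ (Fin n → A) :=
  ⟨fun _ => Finset.prod_nonneg fun _ _ => (hf _).1 _,
    sum_prod_pi_eq_one f fun t => (hf t).2⟩

/-- Memoryless extension of the kernels to blocks of length `n`. -/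
def pow (K : ReceiverKernel 𝒳 𝒴 𝒱₀ 𝒱) (n : ℕ) :
    ReceiverKernel (Fin n → 𝒳) (Fin n → 𝒴) (Fin n → 𝒱₀) (Fin n → 𝒱) where
  q x w v := ∏ t, K.q (x t) (w t) (v t)
  r w v := ∏ t, K.r (w t) (v t)
  s y w v := ∏ t, K.s (y t) (w t) (v t)
  t w y v := ∏ t, K.t (w t) (y t) (v t)
  q_mem x w := pow_mem_stdSimplex fun t => K.q_mem (x t) (w t)
  r_mem w := pow_mem_stdSimplex fun t => K.r_mem (w t)
  s_nonneg _ _ _ := Finset.prod_nonneg fun _ _ => K.s_nonneg _ _ _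
  s_sum y := by
    have h : ∀ w : Fin n → 𝒱₀, ∑ v : Fin n → 𝒱, ∏ t, K.s (y t) (w t) (v t) =
        ∏ t, ∑ v, K.s (y t) (w t) v := fun w => sum_prod_pi fun t v => K.s (y t) (w t) v
    simp only [h]
    exact sum_prod_pi_eq_one (fun t w => ∑ v, K.s (y t) w v) fun t => K.s_sum _
  t_mem w y := pow_mem_stdSimplex fun t => K.t_mem (w t) (y t)

end ReceiverKernel

/-- `one_shot` for the tests defined by receiver kernels. -/
theorem one_shot_kernel {S 𝒳 𝒴₁ 𝒴₂ V₀ V₁ V₂ : Type*} [Fintype S] [Fintype 𝒳] [Fintype V₀]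
    [Fintype V₁] [Fintype V₂] [Nonempty V₁] [Nonempty V₂]
    (μ : S → ℝ) (hμ : μ ∈ stdSimplex ℝ S) (X : S → 𝒳) (Y₁ : S → 𝒴₁) (Y₂ : S → 𝒴₂)
    (q₀ : 𝒳 → V₀ → ℝ) (hq₀ : ∀ x, q₀ x ∈ stdSimplex ℝ V₀)
    (r₀ : V₀ → ℝ) (hr₀ : r₀ ∈ stdSimplex ℝ V₀)
    (K₁ : ReceiverKernel 𝒳 𝒴₁ V₀ V₁) (K₂ : ReceiverKernel 𝒳 𝒴₂ V₀ V₂)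
    (good₁ : 𝒳 → V₁ → Prop) (good₂ : 𝒳 → V₂ → Prop)
    {L₀ L₁ L₂ α₁ α₂ β₁ β₂ : ℝ} (hL₀ : 1 ≤ L₀) (hL₁ : 1 ≤ L₁) (hL₂ : 1 ≤ L₂)
    (hα₁ : 0 ≤ α₁) (hα₂ : 0 ≤ α₂) (hβ₁ : 0 ≤ β₁) (hβ₂ : 0 ≤ β₂)
    {M₀ M₁ M₂ B₀ B₁ B₂ : ℕ} (hM₀ : 0 < M₀) (hM₁ : 0 < M₁) (hM₂ : 0 < M₂)
    (hB₀ : 0 < B₀) (hB₁ : 0 < B₁) (hB₂ : 0 < B₂) :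
    ∃ (enc : 𝒳 → Fin B₀ × Fin B₁ × Fin B₂) (dec₁ : Fin B₀ → Fin B₁ → 𝒴₁ → V₁)
      (dec₂ : Fin B₀ → Fin B₂ → 𝒴₂ → V₂),
      ∑ s, μ s * ind (¬ good₁ (X s) (dec₁ (enc (X s)).1 (enc (X s)).2.1 (Y₁ s))) +
      ∑ s, μ s * ind (¬ good₂ (X s) (dec₂ (enc (X s)).1 (enc (X s)).2.2 (Y₂ s))) ≤
      ∑ s, μ s * ∑ w, q₀ (X s) w * (∑ v, K₁.q (X s) w v *
        ind (¬ K₁.Test q₀ r₀ L₀ L₁ α₁ β₁ good₁ (X s) (Y₁ s) w v)) +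
      ∑ s, μ s * ∑ w, q₀ (X s) w * (∑ v, K₂.q (X s) w v *
        ind (¬ K₂.Test q₀ r₀ L₀ L₂ α₂ β₂ good₂ (X s) (Y₂ s) w v)) +
      (2 * (1 - 1 / L₀) ^ M₀ + (1 - 1 / L₁) ^ M₁ + (1 - 1 / L₂) ^ M₂) +
      (M₀ * M₁ * α₁ / (B₀ * B₁) + M₁ * β₁ / B₁ + M₀ * M₂ * α₂ / (B₀ * B₂) + M₂ * β₂ / B₂) :=
  one_shot μ hμ X Y₁ Y₂ q₀ hq₀ r₀ hr₀ K₁.q K₁.q_mem K₁.r K₁.r_mem K₂.q K₂.q_mem K₂.r K₂.r_mem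
    (K₁.Test q₀ r₀ L₀ L₁ α₁ β₁ good₁) (K₁.Dec r₀ α₁ β₁) good₁
    (K₂.Test q₀ r₀ L₀ L₂ α₂ β₂ good₂) (K₂.Dec r₀ α₂ β₂) good₂ hL₀ hL₁ hL₂
    (fun _ _ _ _ h => h.1) (fun _ _ _ _ h => h.1)
    (fun _ _ _ _ h => h.2.1) (fun _ _ _ _ h => h.2.1)
    (fun _ _ _ _ h => h.2.2.1) (fun _ _ _ _ h => h.2.2.2)
    (fun _ _ _ _ h => h.2.2.1) (fun _ _ _ _ h => h.2.2.2)
    (K₁.sum_dec_le hα₁) (K₂.sum_dec_le hα₂) (K₁.sum_dec_fiber_le hβ₁) (K₂.sum_dec_fiber_le hβ₂)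
    hM₀ hM₁ hM₂ hB₀ hB₁ hB₂

/-- The joint law of the source letter, the common codeword letter and the private codeword
letter. -/
def jointLaw {Z 𝒳 𝒴 𝒱₀ 𝒱 : Type*} [Fintype 𝒱₀] [Fintype 𝒱] (P : Z → ℝ) (ξ : Z → 𝒳)
    (q₀ : 𝒳 → 𝒱₀ → ℝ) (K : ReceiverKernel 𝒳 𝒴 𝒱₀ 𝒱) (u : Z × 𝒱₀ × 𝒱) : ℝ :=
  P u.1 * (q₀ (ξ u.1) u.2.1 * K.q (ξ u.1) u.2.1 u.2.2)

/-- The expected log-likelihood ratios of the kernels under the joint law. -/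
structure RateData {Z 𝒳 𝒴 𝒱₀ 𝒱 : Type*} [Fintype Z] [Fintype 𝒱₀] [Fintype 𝒱] (P : Z → ℝ)
    (ξ : Z → 𝒳) (η : Z → 𝒴) (q₀ : 𝒳 → 𝒱₀ → ℝ) (r₀ : 𝒱₀ → ℝ) (K : ReceiverKernel 𝒳 𝒴 𝒱₀ 𝒱)
    (a₀ a e b : ℝ) : Prop where
  r₀_pos : ∀ u, 0 < jointLaw P ξ q₀ K u → 0 < r₀ u.2.1
  r_pos : ∀ u, 0 < jointLaw P ξ q₀ K u → 0 < K.r u.2.1 u.2.2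
  q₀_pos : ∀ u, 0 < jointLaw P ξ q₀ K u → 0 < q₀ (ξ u.1) u.2.1
  q_pos : ∀ u, 0 < jointLaw P ξ q₀ K u → 0 < K.q (ξ u.1) u.2.1 u.2.2
  s_pos : ∀ u, 0 < jointLaw P ξ q₀ K u → 0 < K.s (η u.1) u.2.1 u.2.2
  t_pos : ∀ u, 0 < jointLaw P ξ q₀ K u → 0 < K.t u.2.1 (η u.1) u.2.2
  sum_q₀ : ∑ u, jointLaw P ξ q₀ K u * Real.logb 2 (q₀ (ξ u.1) u.2.1 / r₀ u.2.1) = a₀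
  sum_q : ∑ u, jointLaw P ξ q₀ K u *
    Real.logb 2 (K.q (ξ u.1) u.2.1 u.2.2 / K.r u.2.1 u.2.2) = a
  sum_s : ∑ u, jointLaw P ξ q₀ K u *
    Real.logb 2 (r₀ u.2.1 * K.r u.2.1 u.2.2 / K.s (η u.1) u.2.1 u.2.2) = -e
  sum_t : ∑ u, jointLaw P ξ q₀ K u *
    Real.logb 2 (K.r u.2.1 u.2.2 / K.t u.2.1 (η u.1) u.2.2) = -b

/-! ### The encoding test on long blocks -/

section Asymptotics

set_option linter.unusedSectionVars false

lemma sum_pi_prod {A B : Type*} [Fintype A] [Fintype B] {n : ℕ}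
    (F : (Fin n → A) → (Fin n → B) → ℝ) :
    ∑ u : Fin n → A × B, F (fun t => (u t).1) (fun t => (u t).2) = ∑ a, ∑ b, F a b := by
  rw [← Fintype.sum_prod_type' F]
  exact (Equiv.arrowProdEquivProdArrow (Fin n) (fun _ => A) (fun _ => B)).sum_comp
    fun x => F x.1 x.2

variable {Z 𝒳 𝒴 𝒱₀ 𝒱 : Type*} [Fintype Z] [Fintype 𝒳] [Fintype 𝒱₀] [Fintype 𝒱]
  {P : Z → ℝ} {ξ : Z → 𝒳} {η : Z → 𝒴} {q₀ : 𝒳 → 𝒱₀ → ℝ} {r₀ : 𝒱₀ → ℝ}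
  {K : ReceiverKernel 𝒳 𝒴 𝒱₀ 𝒱} {a₀ a e b : ℝ}

lemma jointLaw_mem_stdSimplex (hP : P ∈ stdSimplex ℝ Z) (hq₀ : ∀ x, q₀ x ∈ stdSimplex ℝ 𝒱₀)
    (K : ReceiverKernel 𝒳 𝒴 𝒱₀ 𝒱) : jointLaw P ξ q₀ K ∈ stdSimplex ℝ (Z × 𝒱₀ × 𝒱) := by
  refine ⟨fun u => mul_nonneg (hP.1 _) (mul_nonneg ((hq₀ _).1 _) ((K.q_mem _ _).1 _)), ?_⟩
  simp only [jointLaw, Fintype.sum_prod_type, ← Finset.mul_sum, (K.q_mem _ _).2, mul_one,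
    (hq₀ _).2, hP.2]

/-- The random triple of source, common codeword and private codeword passes the encoding test
with probability tending to one. -/
lemma tendsto_test (hP : P ∈ stdSimplex ℝ Z) (hq₀ : ∀ x, q₀ x ∈ stdSimplex ℝ 𝒱₀)
    (hK : RateData P ξ η q₀ r₀ K a₀ a e b) {p : 𝒳 × 𝒱 → ℝ}
    (hp : ∀ y, ∑ u, jointLaw P ξ q₀ K u * ind ((ξ u.1, u.2.2) = y) = p y)
    {δ ε : ℝ} (hδ : 0 < δ) (hε : 0 < ε) :
    Tendsto (fun n : ℕ => ∑ s, iidLaw P n s * ∑ w : Fin n → 𝒱₀, (∏ t, q₀ (ξ (s t)) (w t)) *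
      (∑ v, (K.pow n).q (fun t => ξ (s t)) w v * ind (¬ (K.pow n).Test
        (fun x w => ∏ t, q₀ (x t) (w t)) (fun w => ∏ t, r₀ (w t))
        ((2 : ℝ) ^ ((n : ℝ) * (a₀ + δ))) ((2 : ℝ) ^ ((n : ℝ) * (a + δ)))
        ((2 : ℝ) ^ ((n : ℝ) * (-e + δ))) ((2 : ℝ) ^ ((n : ℝ) * (-b + δ)))
        (fun x v => (fun t => (x t, v t)) ∈ typicalSet n ε p)
        (fun t => ξ (s t)) (fun t => η (s t)) w v))) atTop (𝓝 0) := by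
  have hJ := jointLaw_mem_stdSimplex (ξ := ξ) hP hq₀ K
  have h1 := tendsto_iidProb_ratio hJ _ _ hK.q₀_pos hK.r₀_pos hK.sum_q₀ hδ
  have h2 := tendsto_iidProb_ratio hJ _ _ hK.q_pos hK.r_pos hK.sum_q hδ
  have h3 := tendsto_iidProb_ratio hJ _ _ (fun u hu => mul_pos (hK.r₀_pos u hu) (hK.r_pos u hu))
    hK.s_pos hK.sum_s hδ
  have h4 := tendsto_iidProb_ratio hJ _ _ hK.r_pos hK.t_pos hK.sum_t hδ
  have h5 := tendsto_iidProb_not_typical hJ (fun u => (ξ u.1, u.2.2)) p hp hε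
  have hlim := ((h1.add h2).add (h3.add h4)).add h5
  simp only [add_zero] at hlim
  refine squeeze_zero (fun n => ?_) (fun n => ?_) hlim
  · exact Finset.sum_nonneg fun s _ => mul_nonneg ((iidLaw_mem_stdSimplex hP n).1 _)
      (Finset.sum_nonneg fun w _ => mul_nonneg
        (Finset.prod_nonneg fun _ _ => (hq₀ _).1 _)
        (sum_mul_ind_nonneg ((K.pow n).q_mem _ _) _))
  · set T : (Fin n → Z) → (Fin n → 𝒱₀) → (Fin n → 𝒱) → Prop := fun s w v => (K.pow n).Test
        (fun x w => ∏ t, q₀ (x t) (w t)) (fun w => ∏ t, r₀ (w t))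
        ((2 : ℝ) ^ ((n : ℝ) * (a₀ + δ))) ((2 : ℝ) ^ ((n : ℝ) * (a + δ)))
        ((2 : ℝ) ^ ((n : ℝ) * (-e + δ))) ((2 : ℝ) ^ ((n : ℝ) * (-b + δ)))
        (fun x v => (fun t => (x t, v t)) ∈ typicalSet n ε p)
        (fun t => ξ (s t)) (fun t => η (s t)) w v with hT
    set G : (Fin n → Z) → (Fin n → 𝒱₀) → (Fin n → 𝒱) → ℝ := fun s w v =>
      iidLaw P n s * ((∏ t, q₀ (ξ (s t)) (w t)) *
        ((∏ t, K.q (ξ (s t)) (w t) (v t)) * ind (¬ T s w v))) with hG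
    -- The triples of source, common and private letters are i.i.d. with law `jointLaw`, so the
    -- nested average is one probability for that law.
    have hsum : ∑ s, iidLaw P n s * ∑ w : Fin n → 𝒱₀, (∏ t, q₀ (ξ (s t)) (w t)) *
        (∑ v, (K.pow n).q (fun t => ξ (s t)) w v * ind (¬ T s w v)) =
        iidProb (jointLaw P ξ q₀ K) n fun u =>
          ¬ T (fun t => (u t).1) (fun t => (u t).2.1) (fun t => (u t).2.2) := by
      calc _ = ∑ s, ∑ x : Fin n → 𝒱₀ × 𝒱, G s (fun t => (x t).1) (fun t => (x t).2) := by
            refine Finset.sum_congr rfl fun s _ => ?_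
            rw [sum_pi_prod (G s)]
            simp only [Finset.mul_sum]
            rfl
        _ = ∑ u : Fin n → Z × 𝒱₀ × 𝒱,
              G (fun t => (u t).1) (fun t => (u t).2.1) (fun t => (u t).2.2) :=
            (sum_pi_prod fun s (x : Fin n → 𝒱₀ × 𝒱) =>
              G s (fun t => (x t).1) (fun t => (x t).2)).symm
        _ = _ := by
            refine Finset.sum_congr rfl fun u _ => ?_
            simp only [hG, iidLaw, jointLaw, Finset.prod_mul_distrib, mul_assoc]
    refine le_trans (le_of_eq hsum) ?_
    -- A failed test means that one of four likelihood ratios exceeds its exponent by more than `δ`,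
    -- or that source and private codeword are not jointly typical.
    refine le_trans (iidProb_mono hJ (F := fun u =>
      ((¬ ∏ t, q₀ (ξ (u t).1) (u t).2.1 ≤
            (2 : ℝ) ^ ((n : ℝ) * (a₀ + δ)) * ∏ t, r₀ (u t).2.1) ∨
        (¬ ∏ t, K.q (ξ (u t).1) (u t).2.1 (u t).2.2 ≤
            (2 : ℝ) ^ ((n : ℝ) * (a + δ)) * ∏ t, K.r (u t).2.1 (u t).2.2)) ∨
      ((¬ ∏ t, (r₀ (u t).2.1 * K.r (u t).2.1 (u t).2.2) ≤
            (2 : ℝ) ^ ((n : ℝ) * (-e + δ)) * ∏ t, K.s (η (u t).1) (u t).2.1 (u t).2.2) ∨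
        (¬ ∏ t, K.r (u t).2.1 (u t).2.2 ≤
            (2 : ℝ) ^ ((n : ℝ) * (-b + δ)) * ∏ t, K.t (u t).2.1 (η (u t).1) (u t).2.2)) ∨
      (fun t => (ξ (u t).1, (u t).2.2)) ∉ typicalSet n ε p) fun u _ h => ?_) ?_
    · by_contra hcon
      push Not at hcon
      obtain ⟨⟨c1, c2⟩, ⟨c3, c4⟩, c5⟩ := hcon
      exact h ⟨c1, c2, ⟨by rw [Finset.prod_mul_distrib] at c3; exact c3, c4⟩, c5⟩
    · refine (iidProb_or_le hJ _ _ _).trans ?_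
      rw [add_assoc (_ + _)]
      exact add_le_add (iidProb_or_le hJ _ _ _) ((iidProb_or_le hJ _ _ _).trans
        (add_le_add (iidProb_or_le hJ _ _ _) le_rfl))

end Asymptotics

/-! ### Exponential estimates -/

lemma one_le_two_rpow {n : ℕ} {a : ℝ} (ha : 0 ≤ a) : (1 : ℝ) ≤ 2 ^ ((n : ℝ) * a) :=
  Real.one_le_rpow (by norm_num) (by positivity)

lemma two_rpow_eq_pow (n : ℕ) (a : ℝ) : (2 : ℝ) ^ ((n : ℝ) * a) = ((2 : ℝ) ^ a) ^ n := by
  rw [mul_comm, Real.rpow_mul (by norm_num), Real.rpow_natCast]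

lemma tendsto_two_rpow_neg {c : ℝ} (hc : c < 0) :
    Tendsto (fun n : ℕ => (2 : ℝ) ^ ((n : ℝ) * c)) atTop (𝓝 0) := by
  simp only [two_rpow_eq_pow]
  exact tendsto_pow_atTop_nhds_zero_of_lt_one (by positivity)
    (Real.rpow_lt_one_of_one_lt_of_neg (by norm_num) hc)

lemma tendsto_two_rpow_pos {c : ℝ} (hc : 0 < c) :
    Tendsto (fun n : ℕ => (2 : ℝ) ^ ((n : ℝ) * c)) atTop atTop := by
  simp only [two_rpow_eq_pow]
  exact tendsto_pow_atTop_atTop_of_one_lt (Real.one_lt_rpow (by norm_num) hc)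

/-- The number of codewords of a codebook of rate `a`. -/
noncomputable def codebookSize (n : ℕ) (a : ℝ) : ℕ := ⌈(2 : ℝ) ^ ((n : ℝ) * a)⌉₊

lemma codebookSize_pos (n : ℕ) (a : ℝ) : 0 < codebookSize n a := Nat.ceil_pos.2 (by positivity)

lemma le_codebookSize (n : ℕ) (a : ℝ) : (2 : ℝ) ^ ((n : ℝ) * a) ≤ codebookSize n a :=
  Nat.le_ceil _

lemma codebookSize_le (n : ℕ) {a : ℝ} (ha : 0 ≤ a) :
    (codebookSize n a : ℝ) ≤ 2 * 2 ^ ((n : ℝ) * a) := by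
  have h1 : (codebookSize n a : ℝ) < 2 ^ ((n : ℝ) * a) + 1 := Nat.ceil_lt_add_one (by positivity)
  linarith [one_le_two_rpow (n := n) ha]

lemma numMessages_pos (n : ℕ) {R : ℝ} (hR : 0 ≤ R) : 0 < numMessages n R :=
  Nat.floor_pos.2 (one_le_two_rpow hR)

lemma le_numMessages (n : ℕ) {R : ℝ} (hR : 0 ≤ R) :
    (2 : ℝ) ^ ((n : ℝ) * R) ≤ 2 * numMessages n R := by
  have h1 : (2 : ℝ) ^ ((n : ℝ) * R) < numMessages n R + 1 := Nat.lt_floor_add_one _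
  have h2 : (1 : ℝ) ≤ numMessages n R := by exact_mod_cast numMessages_pos n hR
  linarith

/-- By 1 − x ≤ exp(−x): the codebook exceeds 2^{n(a+δ)} by a factor of at least 2^{nδ}, so the error
is at most exp(−2^{nδ}). -/
lemma tendsto_cover_error {a δ : ℝ} (ha : 0 ≤ a) (hδ : 0 < δ) :
    Tendsto (fun n : ℕ => (1 - 1 / (2 : ℝ) ^ ((n : ℝ) * (a + δ))) ^ codebookSize n (a + 2 * δ))
      atTop (𝓝 0) := by
  have hlim : Tendsto (fun n : ℕ => Real.exp (-(2 : ℝ) ^ ((n : ℝ) * δ))) atTop (𝓝 0) :=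
    Real.tendsto_exp_neg_atTop_nhds_zero.comp (tendsto_two_rpow_pos hδ)
  have hbase : ∀ n : ℕ, 0 ≤ 1 - 1 / (2 : ℝ) ^ ((n : ℝ) * (a + δ)) := fun n => by
    have h := one_le_two_rpow (n := n) (by linarith : 0 ≤ a + δ)
    rw [sub_nonneg, div_le_one (by linarith)]
    exact h
  refine squeeze_zero (fun n => pow_nonneg (hbase n) _) (fun n => ?_) hlim
  calc (1 - 1 / (2 : ℝ) ^ ((n : ℝ) * (a + δ))) ^ codebookSize n (a + 2 * δ)
      ≤ (Real.exp (-(1 / (2 : ℝ) ^ ((n : ℝ) * (a + δ))))) ^ codebookSize n (a + 2 * δ) :=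
        pow_le_pow_left₀ (hbase n) (Real.one_sub_le_exp_neg _) _
    _ = Real.exp (-(codebookSize n (a + 2 * δ) * (1 / (2 : ℝ) ^ ((n : ℝ) * (a + δ))))) := by
        rw [← Real.exp_nat_mul]; congr 1; ring
    _ ≤ _ := by
        refine Real.exp_le_exp.2 (neg_le_neg ?_)
        rw [mul_one_div, le_div_iff₀ (by positivity), ← Real.rpow_add (by norm_num)]
        refine le_trans (le_of_eq ?_) (le_codebookSize n _)
        congr 1; ring

lemma tendsto_pair_confusion {a₀ a α R₀ R : ℝ} (ha₀ : 0 ≤ a₀) (ha : 0 ≤ a) (hR₀ : 0 ≤ R₀)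
    (hR : 0 ≤ R) (h : a₀ + a + α < R₀ + R) :
    Tendsto (fun n : ℕ => (codebookSize n a₀ : ℝ) * codebookSize n a * 2 ^ ((n : ℝ) * α) /
      (numMessages n R₀ * numMessages n R)) atTop (𝓝 0) := by
  -- Rounding costs a factor 2 for each of the two codebook sizes and each of the two message
  -- counts.
  have hlim := (tendsto_two_rpow_neg (c := a₀ + a + α - (R₀ + R)) (by linarith)).const_mul 16
  rw [mul_zero] at hlim
  refine squeeze_zero (fun n => by positivity) (fun n => ?_) hlim
  have hB₀ : (0 : ℝ) < numMessages n R₀ := by exact_mod_cast numMessages_pos n hR₀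
  have hB : (0 : ℝ) < numMessages n R := by exact_mod_cast numMessages_pos n hR
  rw [div_le_iff₀ (by positivity)]
  calc (codebookSize n a₀ : ℝ) * codebookSize n a * 2 ^ ((n : ℝ) * α)
      ≤ (2 * 2 ^ ((n : ℝ) * a₀)) * (2 * 2 ^ ((n : ℝ) * a)) * 2 ^ ((n : ℝ) * α) := by
        gcongr
        · exact codebookSize_le n ha₀
        · exact codebookSize_le n ha
    _ = 4 * 2 ^ ((n : ℝ) * (a₀ + a + α - (R₀ + R))) *
        (2 ^ ((n : ℝ) * R₀) * 2 ^ ((n : ℝ) * R)) := by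
        have : (2 : ℝ) ^ ((n : ℝ) * a₀) * 2 ^ ((n : ℝ) * a) * 2 ^ ((n : ℝ) * α) =
            2 ^ ((n : ℝ) * (a₀ + a + α - (R₀ + R))) * (2 ^ ((n : ℝ) * R₀) * 2 ^ ((n : ℝ) * R)) := by
          simp only [← Real.rpow_add (by norm_num : (0 : ℝ) < 2)]
          congr 1; ring
        linear_combination 4 * this
    _ ≤ 4 * 2 ^ ((n : ℝ) * (a₀ + a + α - (R₀ + R))) *
        ((2 * numMessages n R₀) * (2 * numMessages n R)) := by
        gcongr
        · exact le_numMessages n hR₀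
        · exact le_numMessages n hR
    _ = _ := by ring

lemma tendsto_private_confusion {a β R : ℝ} (ha : 0 ≤ a) (hR : 0 ≤ R) (h : a + β < R) :
    Tendsto (fun n : ℕ => (codebookSize n a : ℝ) * 2 ^ ((n : ℝ) * β) / numMessages n R)
      atTop (𝓝 0) := by
  have hlim := (tendsto_two_rpow_neg (c := a + β - R) (by linarith)).const_mul 4
  rw [mul_zero] at hlim
  refine squeeze_zero (fun n => by positivity) (fun n => ?_) hlim
  have hB : (0 : ℝ) < numMessages n R := by exact_mod_cast numMessages_pos n hR
  rw [div_le_iff₀ hB]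
  calc (codebookSize n a : ℝ) * 2 ^ ((n : ℝ) * β)
      ≤ 2 * 2 ^ ((n : ℝ) * a) * 2 ^ ((n : ℝ) * β) := by
        gcongr
        exact codebookSize_le n ha
    _ = 2 * 2 ^ ((n : ℝ) * (a + β - R)) * 2 ^ ((n : ℝ) * R) := by
        have : (2 : ℝ) ^ ((n : ℝ) * a) * 2 ^ ((n : ℝ) * β) =
            2 ^ ((n : ℝ) * (a + β - R)) * 2 ^ ((n : ℝ) * R) := by
          simp only [← Real.rpow_add (by norm_num : (0 : ℝ) < 2)]
          congr 1; ring
        linear_combination 2 * this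
    _ ≤ 2 * 2 ^ ((n : ℝ) * (a + β - R)) * (2 * numMessages n R) := by
        gcongr
        exact le_numMessages n hR
    _ = _ := by ring

/-- Achievability in terms of the expected log-likelihood ratios of the receiver kernels. -/
theorem epsAchievable_of_rateData {𝒳 𝒴₁ 𝒴₂ 𝒱₀ 𝒱₁ 𝒱₂ : Type*} [Fintype 𝒳] [Fintype 𝒴₁]
    [Fintype 𝒴₂] [Fintype 𝒱₀] [Fintype 𝒱₁] [Fintype 𝒱₂] [Nonempty 𝒱₁] [Nonempty 𝒱₂]
    {P : 𝒳 × 𝒴₁ × 𝒴₂ → ℝ} (hP : P ∈ stdSimplex ℝ (𝒳 × 𝒴₁ × 𝒴₂))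
    (W₁ : 𝒳 → 𝒱₁ → ℝ) (W₂ : 𝒳 → 𝒱₂ → ℝ) {q₀ : 𝒳 → 𝒱₀ → ℝ} (hq₀ : ∀ x, q₀ x ∈ stdSimplex ℝ 𝒱₀)
    {r₀ : 𝒱₀ → ℝ} (hr₀ : r₀ ∈ stdSimplex ℝ 𝒱₀)
    {K₁ : ReceiverKernel 𝒳 𝒴₁ 𝒱₀ 𝒱₁} {K₂ : ReceiverKernel 𝒳 𝒴₂ 𝒱₀ 𝒱₂}
    {a₀ a₁ a₂ e₁ e₂ b₁ b₂ : ℝ}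
    (hK₁ : RateData P Prod.fst (fun z => z.2.1) q₀ r₀ K₁ a₀ a₁ e₁ b₁)
    (hK₂ : RateData P Prod.fst (fun z => z.2.2) q₀ r₀ K₂ a₀ a₂ e₂ b₂)
    (hp₁ : ∀ y, ∑ u, jointLaw P Prod.fst q₀ K₁ u * ind ((u.1.1, u.2.2) = y) =
      sourceRecLaw P W₁ y)
    (hp₂ : ∀ y, ∑ u, jointLaw P Prod.fst q₀ K₂ u * ind ((u.1.1, u.2.2) = y) =
      sourceRecLaw P W₂ y)
    (ha₀ : 0 ≤ a₀) (ha₁ : 0 ≤ a₁) (ha₂ : 0 ≤ a₂) {R : ℝ × ℝ × ℝ} (hR : NonnegTriple R)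
    (h₁ : a₁ - b₁ < R.2.1) (h₂ : a₂ - b₂ < R.2.2)
    (h₀₁ : a₀ + a₁ - e₁ < R.1 + R.2.1) (h₀₂ : a₀ + a₂ - e₂ < R.1 + R.2.2)
    {ε : ℝ} (hε : 0 < ε) : EpsAchievable P W₁ W₂ ε R := by
  -- Each likelihood test has slack `δ`, and each codebook exponent has `2 * δ` in order to beat its
  -- covering test. Private confusion involves one codebook and one test, hence `3 * δ`; pair
  -- confusion two codebooks and one test, hence `5 * δ`.
  obtain ⟨δ, hδ, hδ₁, hδ₂, hδ₀₁, hδ₀₂⟩ : ∃ δ > 0, a₁ - b₁ + 3 * δ < R.2.1 ∧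
      a₂ - b₂ + 3 * δ < R.2.2 ∧ a₀ + a₁ - e₁ + 5 * δ < R.1 + R.2.1 ∧
      a₀ + a₂ - e₂ + 5 * δ < R.1 + R.2.2 := by
    have hlim : ∀ c x y : ℝ, x < y → ∀ᶠ δ in 𝓝[>] (0 : ℝ), x + c * δ < y := by
      intro c x y hxy
      have : Tendsto (fun δ : ℝ => x + c * δ) (𝓝 0) (𝓝 (x + c * 0)) :=
        (continuous_const.add (continuous_const.mul continuous_id)).tendsto 0
      rw [mul_zero, add_zero] at this
      exact (this.mono_left nhdsWithin_le_nhds).eventually_lt_const hxy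
    obtain ⟨δ, hδ⟩ := ((hlim 3 _ _ h₁).and ((hlim 3 _ _ h₂).and ((hlim 5 _ _ h₀₁).and
      ((hlim 5 _ _ h₀₂).and (eventually_mem_nhdsWithin (s := Ioi (0 : ℝ)))))) ).exists
    exact ⟨δ, hδ.2.2.2.2, hδ.1, hδ.2.1, hδ.2.2.1, hδ.2.2.2.1⟩
  have hone := fun n : ℕ => one_shot_kernel (iidLaw P n) (iidLaw_mem_stdSimplex hP n)
    (fun s t => (s t).1) (fun s t => (s t).2.1) (fun s t => (s t).2.2)
    (fun x w => ∏ t, q₀ (x t) (w t))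
    (fun x => ReceiverKernel.pow_mem_stdSimplex fun t => hq₀ (x t))
    (fun w => ∏ t, r₀ (w t)) (ReceiverKernel.pow_mem_stdSimplex fun _ => hr₀)
    (K₁.pow n) (K₂.pow n)
    (fun x v => (fun t => (x t, v t)) ∈ typicalSet n ε (sourceRecLaw P W₁))
    (fun x v => (fun t => (x t, v t)) ∈ typicalSet n ε (sourceRecLaw P W₂))
    (one_le_two_rpow (n := n) (by linarith : 0 ≤ a₀ + δ))
    (one_le_two_rpow (n := n) (by linarith : 0 ≤ a₁ + δ))
    (one_le_two_rpow (n := n) (by linarith : 0 ≤ a₂ + δ))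
    (by positivity : (0 : ℝ) ≤ 2 ^ ((n : ℝ) * (-e₁ + δ)))
    (by positivity : (0 : ℝ) ≤ 2 ^ ((n : ℝ) * (-e₂ + δ)))
    (by positivity : (0 : ℝ) ≤ 2 ^ ((n : ℝ) * (-b₁ + δ)))
    (by positivity : (0 : ℝ) ≤ 2 ^ ((n : ℝ) * (-b₂ + δ)))
    (codebookSize_pos n (a₀ + 2 * δ)) (codebookSize_pos n (a₁ + 2 * δ))
    (codebookSize_pos n (a₂ + 2 * δ))
    (numMessages_pos n hR.1) (numMessages_pos n hR.2.1) (numMessages_pos n hR.2.2)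
  choose enc dec₁ dec₂ hle using hone
  have hlim := (((tendsto_test hP hq₀ hK₁ hp₁ hδ hε).add (tendsto_test hP hq₀ hK₂ hp₂ hδ hε)).add
    ((((tendsto_cover_error ha₀ hδ).const_mul 2).add (tendsto_cover_error ha₁ hδ)).add
      (tendsto_cover_error ha₂ hδ))).add
    ((((tendsto_pair_confusion (a₀ := a₀ + 2 * δ) (a := a₁ + 2 * δ) (α := -e₁ + δ)
        (by linarith) (by linarith) hR.1 hR.2.1 (by linarith)).add
      (tendsto_private_confusion (a := a₁ + 2 * δ) (β := -b₁ + δ)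
        (by linarith) hR.2.1 (by linarith))).add
      (tendsto_pair_confusion (a₀ := a₀ + 2 * δ) (a := a₂ + 2 * δ) (α := -e₂ + δ)
        (by linarith) (by linarith) hR.1 hR.2.2 (by linarith))).add
      (tendsto_private_confusion (a := a₂ + 2 * δ) (β := -b₂ + δ)
        (by linarith) hR.2.2 (by linarith)))
  simp only [mul_zero, add_zero] at hlim
  have hnn : ∀ (n : ℕ) (E : Set (Fin n → 𝒳 × 𝒴₁ × 𝒴₂)),
      0 ≤ ∑ s, iidLaw P n s * ind (s ∈ E) := fun n E =>
    sum_mul_ind_nonneg (iidLaw_mem_stdSimplex hP n) _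
  refine ⟨fun n => ⟨enc n, dec₁ n, dec₂ n⟩, ?_, ?_⟩
  · simp only [prob_eq_sum]
    refine squeeze_zero (fun n => hnn n _) (fun n => le_trans ?_ (hle n)) hlim
    exact le_add_of_nonneg_right (sum_mul_ind_nonneg (iidLaw_mem_stdSimplex hP n) _)
  · simp only [prob_eq_sum]
    refine squeeze_zero (fun n => hnn n _) (fun n => le_trans ?_ (hle n)) hlim
    exact le_add_of_nonneg_left (sum_mul_ind_nonneg (iidLaw_mem_stdSimplex hP n) _)

/-! ### Laws, conditional laws and conditional mutual information -/

section Laws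

variable {Ω : Type*} [Fintype Ω] {α β γ : Type*} {p : Ω → ℝ}

lemma law_eq_sum (p : Ω → ℝ) (A : Ω → α) (a : α) : law p A a = ∑ ω, p ω * ind (A ω = a) :=
  prob_eq_sum p _

lemma law_congr {A : Ω → α} {B : Ω → β} {a : α} {b : β} (h : ∀ ω, A ω = a ↔ B ω = b) :
    law p A a = law p B b := by
  simp only [law_eq_sum, h]

lemma law_nonneg (hp : p ∈ stdSimplex ℝ Ω) (A : Ω → α) (a : α) : 0 ≤ law p A a := by
  rw [law_eq_sum]; exact sum_mul_ind_nonneg hp _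

lemma law_mono (hp : p ∈ stdSimplex ℝ Ω) {A : Ω → α} {B : Ω → β} {a : α} {b : β}
    (h : ∀ ω, A ω = a → B ω = b) : law p A a ≤ law p B b := by
  simp only [law_eq_sum]
  exact Finset.sum_le_sum fun ω _ => mul_le_mul_of_nonneg_left (ind_mono (h ω)) (hp.1 ω)

lemma law_pos (hp : p ∈ stdSimplex ℝ Ω) (A : Ω → α) {ω : Ω} (hω : 0 < p ω) :
    0 < law p A (A ω) := by
  rw [law_eq_sum]
  refine lt_of_lt_of_le hω ?_
  have h := Finset.single_le_sum (f := fun ω' => p ω' * ind (A ω' = A ω))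
    (fun ω' _ => mul_nonneg (hp.1 ω') (ind_nonneg _)) (Finset.mem_univ ω)
  simpa [ind] using h

lemma exists_of_law_pos (hp : p ∈ stdSimplex ℝ Ω) {A : Ω → α} {a : α} (h : 0 < law p A a) :
    ∃ ω, 0 < p ω ∧ A ω = a := by
  by_contra! hcon
  rw [law_eq_sum] at h
  refine h.ne' (Finset.sum_eq_zero fun ω _ => ?_)
  rcases (hp.1 ω).eq_or_lt with h0 | h0
  · rw [← h0, zero_mul]
  · rw [ind_false (hcon ω h0), mul_zero]

/-- The law of the unconscious statistician. -/
lemma sum_law_mul [Fintype α] (p : Ω → ℝ) (A : Ω → α) (F : α → ℝ) :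
    ∑ a, law p A a * F a = ∑ ω, p ω * F (A ω) := by
  classical
  simp only [law_eq_sum, Finset.sum_mul]
  rw [Finset.sum_comm]
  refine Finset.sum_congr rfl fun ω _ => ?_
  simp only [mul_assoc]
  rw [← Finset.mul_sum, sum_ind_eq_mul (A ω) F]

lemma law_comp [Fintype α] (p : Ω → ℝ) (A : Ω → α) (f : α → β) (b : β) :
    law p (fun ω => f (A ω)) b = ∑ a, law p A a * ind (f a = b) := by
  rw [sum_law_mul, law_eq_sum]

lemma sum_law_pair_right [Fintype β] (p : Ω → ℝ) (A : Ω → α) (B : Ω → β) (a : α) :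
    ∑ b, law p (fun ω => (A ω, B ω)) (a, b) = law p A a := by
  classical
  simp only [law_eq_sum, Prod.mk.injEq, ind_and]
  rw [Finset.sum_comm]
  refine Finset.sum_congr rfl fun ω _ => ?_
  rw [← Finset.mul_sum, ← Finset.mul_sum]
  congr 1
  have := sum_ind_eq_mul (B ω) fun _ => (1 : ℝ)
  simp only [mul_one] at this
  rw [this, mul_one]

lemma law_mem_stdSimplex [Fintype α] (hp : p ∈ stdSimplex ℝ Ω) (A : Ω → α) :
    law p A ∈ stdSimplex ℝ α := by
  refine ⟨law_nonneg hp A, ?_⟩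
  have := sum_law_mul p A fun _ => 1
  simpa [hp.2] using this

lemma exists_condLaw [Fintype α] [Fintype β] (hp : p ∈ stdSimplex ℝ Ω) (A : Ω → α) (B : Ω → β) :
    ∃ k : α → β → ℝ, (∀ a, k a ∈ stdSimplex ℝ β) ∧
      ∀ a b, law p (fun ω => (A ω, B ω)) (a, b) = law p A a * k a b := by
  classical
  -- Given an event of probability zero any law would do; `law p B` keeps every `k a` a probability
  -- vector.
  refine ⟨fun a b => if law p A a = 0 then law p B b
    else law p (fun ω => (A ω, B ω)) (a, b) / law p A a, fun a => ?_, fun a b => ?_⟩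
  · by_cases h : law p A a = 0
    · simp only [h, if_true]; exact law_mem_stdSimplex hp B
    · simp only [h, if_false]
      refine ⟨fun b => div_nonneg (law_nonneg hp _ _) (law_nonneg hp _ _), ?_⟩
      rw [← Finset.sum_div, sum_law_pair_right, div_self h]
  · by_cases h : law p A a = 0
    · simp only [h, if_true, zero_mul]
      exact le_antisymm (h ▸ law_mono hp fun ω hω => congrArg Prod.fst hω) (law_nonneg hp _ _)
    · simp only [h, if_false]
      field_simp

lemma condLaw_pos (hp : p ∈ stdSimplex ℝ Ω) {A : Ω → α} {B : Ω → β} {k : α → β → ℝ}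
    (hk : ∀ a b, law p (fun ω => (A ω, B ω)) (a, b) = law p A a * k a b) {ω : Ω} (hω : 0 < p ω) :
    0 < k (A ω) (B ω) := by
  have h1 := law_pos hp (fun ω => (A ω, B ω)) hω
  rw [hk] at h1
  exact pos_of_mul_pos_right h1 (law_nonneg hp _ _)

/-- Gibbs' inequality for conditional laws. -/
lemma sum_logb_condLaw_nonneg [Fintype α] [Fintype β] (hp : p ∈ stdSimplex ℝ Ω) {A : Ω → α}
    {B : Ω → β} {k g : α → β → ℝ}
    (hk : ∀ a b, law p (fun ω => (A ω, B ω)) (a, b) = law p A a * k a b)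
    (hg : ∀ a, g a ∈ stdSimplex ℝ β) (hgpos : ∀ ω, 0 < p ω → 0 < g (A ω) (B ω)) :
    0 ≤ ∑ ω, p ω * Real.logb 2 (k (A ω) (B ω) / g (A ω) (B ω)) := by
  -- Under `k` the ratio `g / k` averages to the mass of `g` on the support of `k`; log x ≥ 1 − 1/x
  -- then gives the claim.
  have h1 : ∑ ω, p ω * (g (A ω) (B ω) / k (A ω) (B ω)) ≤ 1 := by
    rw [← sum_law_mul p (fun ω => (A ω, B ω)) fun x => g x.1 x.2 / k x.1 x.2,
      Fintype.sum_prod_type, ← (law_mem_stdSimplex hp A).2]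
    refine Finset.sum_le_sum fun a _ => ?_
    calc _ ≤ ∑ b, law p A a * g a b := by
          refine Finset.sum_le_sum fun b _ => ?_
          have hnn := mul_nonneg (law_nonneg hp A a) ((hg a).1 b)
          rw [hk]
          by_cases h : k a b = 0
          · simpa [h] using hnn
          · field_simp; exact le_rfl
      _ = law p A a := by rw [← Finset.mul_sum, (hg a).2, mul_one]
  have h2 : ∀ ω, p ω * ((1 - g (A ω) (B ω) / k (A ω) (B ω)) / Real.log 2) ≤
      p ω * Real.logb 2 (k (A ω) (B ω) / g (A ω) (B ω)) := by
    intro ω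
    rcases (hp.1 ω).eq_or_lt with h0 | h0
    · simp [← h0]
    · refine mul_le_mul_of_nonneg_left ?_ h0.le
      have hpos := div_pos (condLaw_pos hp hk h0) (hgpos ω h0)
      have h3 := Real.one_sub_inv_le_log_of_pos hpos
      rw [inv_div] at h3
      exact div_le_div_of_nonneg_right h3 (Real.log_nonneg (by norm_num))
  refine le_trans ?_ (Finset.sum_le_sum fun ω _ => h2 ω)
  simp only [← mul_div_assoc]
  rw [← Finset.sum_div]
  refine div_nonneg ?_ (Real.log_nonneg (by norm_num))
  simp only [mul_sub, mul_one, Finset.sum_sub_distrib, hp.2]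
  linarith

/-- Conditional mutual information as the expectation of the information density. -/
lemma condMutualInfo_eq_sum [Fintype α] [Fintype β] [Fintype γ] (p : Ω → ℝ) (A : Ω → α)
    (B : Ω → β) (C : Ω → γ) :
    condMutualInfo p A B C = ∑ ω, p ω * Real.logb 2
      (law p (fun ω => (A ω, B ω, C ω)) (A ω, B ω, C ω) * law p C (C ω) /
        (law p (fun ω => (A ω, C ω)) (A ω, C ω) * law p (fun ω => (B ω, C ω)) (B ω, C ω))) := by
  have h := sum_law_mul p (fun ω => (A ω, B ω, C ω)) fun x => Real.logb 2
    (law p (fun ω => (A ω, B ω, C ω)) x * law p C x.2.2 /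
        (law p (fun ω => (A ω, C ω)) (x.1, x.2.2) * law p (fun ω => (B ω, C ω)) x.2))
  simp only [Fintype.sum_prod_type] at h
  exact h

lemma sum_mul_congr_of_pos {F G : Ω → ℝ} (hp : p ∈ stdSimplex ℝ Ω)
    (h : ∀ ω, 0 < p ω → F ω = G ω) : ∑ ω, p ω * F ω = ∑ ω, p ω * G ω := by
  refine Finset.sum_congr rfl fun ω _ => ?_
  rcases (hp.1 ω).eq_or_lt with h0 | h0
  · simp [← h0]
  · rw [h ω h0]

/-- The chain rule `I(A; B, C | D) = I(A; B | D) + I(A; C | B, D)`. -/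
lemma condMutualInfo_chain {δ : Type*} [Fintype α] [Fintype β] [Fintype γ] [Fintype δ]
    (hp : p ∈ stdSimplex ℝ Ω) (A : Ω → α) (B : Ω → β) (C : Ω → γ) (D : Ω → δ) :
    condMutualInfo p A (fun ω => (B ω, C ω)) D =
      condMutualInfo p A B D + condMutualInfo p A C (fun ω => (B ω, D ω)) := by
  simp only [condMutualInfo_eq_sum]
  rw [← Finset.sum_add_distrib]
  simp only [← mul_add]
  refine sum_mul_congr_of_pos hp fun ω hω => ?_
  have e1 : law p (fun ω => (A ω, (B ω, C ω), D ω)) (A ω, (B ω, C ω), D ω) =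
      law p (fun ω => (A ω, C ω, B ω, D ω)) (A ω, C ω, B ω, D ω) :=
    law_congr fun ω' => by simp only [Prod.mk.injEq]; tauto
  have e2 : law p (fun ω => ((B ω, C ω), D ω)) ((B ω, C ω), D ω) =
      law p (fun ω => (C ω, B ω, D ω)) (C ω, B ω, D ω) :=
    law_congr fun ω' => by simp only [Prod.mk.injEq]; tauto
  have p1 := law_pos hp (fun ω => (A ω, C ω, B ω, D ω)) hω
  have p2 := law_pos hp (fun ω => (C ω, B ω, D ω)) hω
  have p3 := law_pos hp (fun ω => (A ω, B ω, D ω)) hω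
  have p4 := law_pos hp D hω
  have p5 := law_pos hp (fun ω => (A ω, D ω)) hω
  have p6 := law_pos hp (fun ω => (B ω, D ω)) hω
  rw [e1, e2, ← Real.logb_mul (by positivity) (by positivity)]
  congr 1
  field_simp

end Laws

/-- Receiver kernels obtained from the conditional laws of jointly distributed random variables
with the Markov chain `(V₀, V) → X → (Y₁, Y₂)`. -/
theorem exists_receiverKernel {Ω Z 𝒳 𝒴 𝒱₀ 𝒱 : Type*} [Fintype Ω] [Fintype Z] [Fintype 𝒳]
    [Fintype 𝒴] [Fintype 𝒱₀] [Fintype 𝒱] {p : Ω → ℝ} (hp : p ∈ stdSimplex ℝ Ω) (U : Ω → Z)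
    (ξ : Z → 𝒳) (η : Z → 𝒴) (V₀ : Ω → 𝒱₀) (V : Ω → 𝒱)
    (hM : ∀ z w v, law p (fun ω => (U ω, V₀ ω, V ω)) (z, w, v) * law p (fun ω => ξ (U ω)) (ξ z) =
      law p (fun ω => ((ξ (U ω), V₀ ω), V ω)) ((ξ z, w), v) * law p U z)
    {q₀ : 𝒳 → 𝒱₀ → ℝ} (hq₀ : ∀ x w, law p (fun ω => (ξ (U ω), V₀ ω)) (x, w) =
      law p (fun ω => ξ (U ω)) x * q₀ x w)
    {a₀ : ℝ} (ha₀ : ∑ ω, p ω * Real.logb 2 (q₀ (ξ (U ω)) (V₀ ω) / law p V₀ (V₀ ω)) = a₀) :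
    ∃ (K : ReceiverKernel 𝒳 𝒴 𝒱₀ 𝒱) (a e b : ℝ),
      RateData (law p U) ξ η q₀ (law p V₀) K a₀ a e b ∧ 0 ≤ a ∧
      a - b = condMutualInfo p (fun ω => ξ (U ω)) V (fun ω => (V₀ ω, η (U ω))) ∧
      a₀ + a - e = condMutualInfo p (fun ω => ξ (U ω)) (fun ω => (V₀ ω, V ω)) (fun ω => η (U ω)) ∧
      ∀ y, ∑ u, jointLaw (law p U) ξ q₀ K u * ind ((ξ u.1, u.2.2) = y) =
        law p (fun ω => (ξ (U ω), V ω)) y := by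
  obtain ⟨q, hq, hqlaw⟩ := exists_condLaw hp (fun ω => (ξ (U ω), V₀ ω)) V
  obtain ⟨r, hr, hrlaw⟩ := exists_condLaw hp V₀ V
  obtain ⟨s, hs, hslaw⟩ := exists_condLaw hp (fun ω => η (U ω)) (fun ω => (V₀ ω, V ω))
  obtain ⟨t, ht, htlaw⟩ := exists_condLaw hp (fun ω => (V₀ ω, η (U ω))) V
  let K : ReceiverKernel 𝒳 𝒴 𝒱₀ 𝒱 :=
    { q := fun x w => q (x, w)
      r := r
      s := fun y w v => s y (w, v)
      t := fun w y => t (w, y)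
      q_mem := fun x w => hq _
      r_mem := hr
      s_nonneg := fun y w v => (hs y).1 _
      s_sum := fun y => by rw [← Fintype.sum_prod_type]; exact (hs y).2
      t_mem := fun w y => ht _ }
  -- This is where the Markov chain enters: given X, the codewords do not depend on the rest of the
  -- source letter, so the law built from the kernels is the true one. Where X has probability zero
  -- both sides vanish.
  have hJ : ∀ z w v, jointLaw (law p U) ξ q₀ K (z, w, v) =
      law p (fun ω => (U ω, V₀ ω, V ω)) (z, w, v) := by
    intro z w v
    have h1 := hM z w v
    rw [hqlaw, hq₀] at h1
    change law p U z * (q₀ (ξ z) w * q (ξ z, w) v) = _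
    by_cases h : law p (fun ω => ξ (U ω)) (ξ z) = 0
    · have h2 : law p U z = 0 := le_antisymm
        (h ▸ law_mono hp fun ω hω => by rw [hω]) (law_nonneg hp _ _)
      have h3 : law p (fun ω => (U ω, V₀ ω, V ω)) (z, w, v) = 0 := le_antisymm
        (h2 ▸ law_mono hp fun ω hω => congrArg Prod.fst hω) (law_nonneg hp _ _)
      rw [h2, h3, zero_mul]
    · refine mul_right_cancel₀ h ?_
      rw [h1]; ring
  have hJ' : jointLaw (law p U) ξ q₀ K = law p (fun ω => (U ω, V₀ ω, V ω)) :=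
    funext fun u => hJ u.1 u.2.1 u.2.2
  have hsum : ∀ F : Z × 𝒱₀ × 𝒱 → ℝ, ∑ u, jointLaw (law p U) ξ q₀ K u * F u =
      ∑ ω, p ω * F (U ω, V₀ ω, V ω) := fun F => by
    rw [hJ', sum_law_mul p (fun ω => (U ω, V₀ ω, V ω)) F]
  have hsupp : ∀ (Q : Z × 𝒱₀ × 𝒱 → Prop), (∀ ω, 0 < p ω → Q (U ω, V₀ ω, V ω)) →
      ∀ u, 0 < jointLaw (law p U) ξ q₀ K u → Q u := by
    intro Q hQ u hu
    rw [hJ'] at hu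
    obtain ⟨ω, hω, rfl⟩ := exists_of_law_pos hp hu
    exact hQ ω hω
  have pr₀ : ∀ ω, 0 < p ω → 0 < law p V₀ (V₀ ω) := fun ω hω => law_pos hp V₀ hω
  have pq₀ : ∀ ω, 0 < p ω → 0 < q₀ (ξ (U ω)) (V₀ ω) := fun ω hω => condLaw_pos hp hq₀ hω
  have pq : ∀ ω, 0 < p ω → 0 < q (ξ (U ω), V₀ ω) (V ω) := fun ω hω => condLaw_pos hp hqlaw hω
  have pr : ∀ ω, 0 < p ω → 0 < r (V₀ ω) (V ω) := fun ω hω => condLaw_pos hp hrlaw hω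
  have ps : ∀ ω, 0 < p ω → 0 < s (η (U ω)) (V₀ ω, V ω) := fun ω hω => condLaw_pos hp hslaw hω
  have pt : ∀ ω, 0 < p ω → 0 < t (V₀ ω, η (U ω)) (V ω) := fun ω hω => condLaw_pos hp htlaw hω
  -- The conditional factor depends on `z` only through `ξ z`, so it comes out of the sum over the
  -- letters `z` above `(x, y)`.
  have hfull : ∀ x w v y, law p (fun ω => (ξ (U ω), V ω, V₀ ω, η (U ω))) (x, v, w, y) =
      law p (fun ω => (ξ (U ω), η (U ω))) (x, y) * (q₀ x w * q (x, w) v) := by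
    intro x w v y
    rw [law_comp p (fun ω => (U ω, V₀ ω, V ω)) (fun u => (ξ u.1, u.2.2, u.2.1, η u.1)) (x, v, w, y),
      law_comp p U (fun z => (ξ z, η z)) (x, y), Fintype.sum_prod_type, Finset.sum_mul]
    refine Finset.sum_congr rfl fun z _ => ?_
    rw [Finset.sum_eq_single (w, v)]
    · rw [← hJ]
      by_cases h : ξ z = x ∧ η z = y
      · obtain ⟨rfl, rfl⟩ := h
        rw [ind_true rfl, ind_true rfl, mul_one, mul_one]
        rfl
      · rw [ind_false, ind_false]
        · simp
        · simpa using h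
        · simpa using h
    · rintro ⟨w', v'⟩ _ hne
      rw [ind_false, mul_zero]
      simp only [Prod.mk.injEq]
      rintro ⟨_, h1, h2, _⟩
      exact hne (by rw [h1, h2])
    · simp
  have hpart : ∀ x w y, law p (fun ω => (ξ (U ω), V₀ ω, η (U ω))) (x, w, y) =
      law p (fun ω => (ξ (U ω), η (U ω))) (x, y) * q₀ x w := by
    intro x w y
    rw [← sum_law_pair_right p _ V]
    have h1 : ∀ v, law p (fun ω => ((ξ (U ω), V₀ ω, η (U ω)), V ω)) ((x, w, y), v) =
        law p (fun ω => (ξ (U ω), η (U ω))) (x, y) * (q₀ x w * q (x, w) v) := fun v => by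
      rw [← hfull]
      exact law_congr fun ω => by simp only [Prod.mk.injEq]; tauto
    simp only [h1, ← Finset.mul_sum, (hq _).2, mul_one]
  have psxy : ∀ ω, 0 < p ω → 0 < law p (fun ω => (ξ (U ω), η (U ω))) (ξ (U ω), η (U ω)) :=
    fun ω hω => law_pos hp (fun ω => (ξ (U ω), η (U ω))) hω
  -- The three values are I(X;V|V₀), I(V₀,V;Y) and I(V;Y|V₀).
  refine ⟨K, ∑ ω, p ω * Real.logb 2 (q (ξ (U ω), V₀ ω) (V ω) / r (V₀ ω) (V ω)),
    -∑ ω, p ω * Real.logb 2 (law p V₀ (V₀ ω) * r (V₀ ω) (V ω) / s (η (U ω)) (V₀ ω, V ω)),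
    -∑ ω, p ω * Real.logb 2 (r (V₀ ω) (V ω) / t (V₀ ω, η (U ω)) (V ω)), ?_, ?_, ?_, ?_, ?_⟩
  · refine ⟨hsupp _ pr₀, hsupp _ pr, hsupp _ pq₀, hsupp _ pq, hsupp _ ps, hsupp _ pt,
      (hsum _).trans ha₀, hsum _, ?_, ?_⟩
    · rw [neg_neg]; exact hsum _
    · rw [neg_neg]; exact hsum _
  · exact sum_logb_condLaw_nonneg (g := fun a => r a.2) hp hqlaw (fun a => hr _) pr
  -- The identity already holds for the information densities at each outcome of positive
  -- probability: by `hfull` and `hpart`, the law of (X, Y) and `q₀` cancel.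
  · rw [sub_neg_eq_add, ← Finset.sum_add_distrib, condMutualInfo_eq_sum]
    simp only [← mul_add]
    refine sum_mul_congr_of_pos hp fun ω hω => ?_
    have h1 : law p (fun ω => (V ω, V₀ ω, η (U ω))) (V ω, V₀ ω, η (U ω)) =
        law p (fun ω => (V₀ ω, η (U ω))) (V₀ ω, η (U ω)) * t (V₀ ω, η (U ω)) (V ω) := by
      rw [← htlaw]
      exact law_congr fun ω => by simp only [Prod.mk.injEq]; tauto
    have i1 := pq₀ ω hω
    have i2 := pq ω hω
    have i3 := pr ω hω
    have i4 := pt ω hω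
    have i5 := psxy ω hω
    have i6 := law_pos hp (fun ω => (V₀ ω, η (U ω))) hω
    rw [hfull, hpart, h1, ← Real.logb_mul (by positivity) (by positivity)]
    congr 1
    field_simp
  · rw [sub_neg_eq_add, ← ha₀, ← Finset.sum_add_distrib, ← Finset.sum_add_distrib,
      condMutualInfo_eq_sum]
    simp only [← mul_add]
    refine sum_mul_congr_of_pos hp fun ω hω => ?_
    have h1 : law p (fun ω => ((V₀ ω, V ω), η (U ω))) ((V₀ ω, V ω), η (U ω)) =
        law p (fun ω => η (U ω)) (η (U ω)) * s (η (U ω)) (V₀ ω, V ω) := by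
      rw [← hslaw]
      exact law_congr fun ω => by simp only [Prod.mk.injEq]; tauto
    have h2 : law p (fun ω => (ξ (U ω), (V₀ ω, V ω), η (U ω))) (ξ (U ω), (V₀ ω, V ω), η (U ω)) =
        law p (fun ω => (ξ (U ω), V ω, V₀ ω, η (U ω))) (ξ (U ω), V ω, V₀ ω, η (U ω)) :=
      law_congr fun ω => by simp only [Prod.mk.injEq]; tauto
    have i0 := pr₀ ω hω
    have i1 := pq₀ ω hω
    have i2 := pq ω hω
    have i3 := pr ω hω
    have i4 := ps ω hω
    have i5 := psxy ω hω
    have i6 := law_pos hp (fun ω => η (U ω)) hω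
    rw [h2, hfull, h1, ← Real.logb_mul (by positivity) (by positivity),
      ← Real.logb_mul (by positivity) (by positivity)]
    congr 1
    field_simp
  · intro y
    rw [hsum, law_eq_sum]

/-! ### Markov chains under a function of the first variable -/

section MarkovLaws

variable {Ω : Type*} [Fintype Ω] {α β γ δ : Type*} {p : Ω → ℝ}

lemma law_map_left [Fintype α] (p : Ω → ℝ) (A : Ω → α) (D : Ω → δ) (f : α → β) (b : β) (d : δ) :
    law p (fun ω => (f (A ω), D ω)) (b, d) =
      ∑ a, ind (f a = b) * law p (fun ω => (A ω, D ω)) (a, d) := by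
  classical
  simp only [law_eq_sum, Finset.mul_sum, Prod.mk.injEq, ind_and]
  rw [Finset.sum_comm]
  refine Finset.sum_congr rfl fun ω _ => ?_
  rw [← sum_ind_eq_mul (A ω) fun a => ind (f a = b), Finset.sum_mul, Finset.mul_sum]
  exact Finset.sum_congr rfl fun a _ => by ring

/-- The Markov identity is linear in the laws involving `A`, so it can be summed over a fibre of
`f`. It supplies the chain for each pair (V₀, Vᵢ). -/
lemma MarkovChain.map_left [Fintype α] {A : Ω → α} {B : Ω → β} {C : Ω → γ}
    (h : MarkovChain p A B C) (f : α → δ) : MarkovChain p (fun ω => f (A ω)) B C := by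
  intro a b c
  rw [law_map_left p A (fun ω => (B ω, C ω)) f, law_map_left p A B f, Finset.sum_mul,
    Finset.sum_mul]
  exact Finset.sum_congr rfl fun a' _ => by rw [mul_assoc, h a' b c]; ring

end MarkovLaws

/-! ### Inclusions between the regions -/

section Regions

variable {𝒳 𝒴₁ 𝒴₂ 𝒱₁ 𝒱₂ : Type*}
  [Fintype 𝒳] [Fintype 𝒴₁] [Fintype 𝒴₂] [Fintype 𝒱₁] [Fintype 𝒱₂]
  {P : 𝒳 × 𝒴₁ × 𝒴₂ → ℝ} {W₁ : 𝒳 → 𝒱₁ → ℝ} {W₂ : 𝒳 → 𝒱₂ → ℝ}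

/-- With the same auxiliary variable, the bounds on R₀ and Rᵢ add up, by the chain rule, to the
bound on R₀ + Rᵢ. -/
theorem regionInnerStar_subset_regionInner :
    regionInnerStar P W₁ W₂ ⊆ regionInner P W₁ W₂ := by
  refine closure_mono ?_
  rintro R ⟨hR, Ω, 𝒱₀, _, _, p, X, Y₁, Y₂, V₀, V₁, V₂, hA, h0, h1, h2⟩
  refine ⟨hR, Ω, 𝒱₀, _, _, p, X, Y₁, Y₂, V₀, V₁, V₂, hA, h1, h2, ?_, ?_⟩
  · rw [condMutualInfo_chain hA.pmf]
    linarith [(max_lt_iff.1 h0).1]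
  · rw [condMutualInfo_chain hA.pmf]
    linarith [(max_lt_iff.1 h0).2]

/-- Triplets satisfying the strict bounds are themselves achievable, so the sets are compared before
closure. The kernels of receiver i come from the law of (X, Y₁, Y₂, V₀, Vᵢ) alone; the dependence
between V₁ and V₂ plays no role. -/
theorem regionInner_subset_regionLGW : regionInner P W₁ W₂ ⊆ regionLGW P W₁ W₂ := by
  refine closure_mono ?_
  rintro R ⟨hR, Ω, 𝒱₀, _, _, p, X, Y₁, Y₂, V₀, V₁, V₂, hA, h1, h2, h01, h02⟩
  refine ⟨hR, fun ε hε => ?_⟩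
  have hp := hA.pmf
  have hΩ : Nonempty Ω := by
    by_contra h
    rw [not_nonempty_iff] at h
    simpa using hp.2
  have : Nonempty 𝒱₁ := hΩ.map V₁
  have : Nonempty 𝒱₂ := hΩ.map V₂
  set U : Ω → 𝒳 × 𝒴₁ × 𝒴₂ := fun ω => (X ω, Y₁ ω, Y₂ ω) with hU
  obtain ⟨q₀, hq₀, hq₀law⟩ := exists_condLaw hp X V₀
  have hM₁ := hA.markov.map_left fun a => (a.1, a.2.1)
  have hM₂ := hA.markov.map_left fun a => (a.1, a.2.2)
  obtain ⟨K₁, a₁, e₁, b₁, hK₁, ha₁, hab₁, hae₁, hp₁⟩ := exists_receiverKernel hp U Prod.fst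
    (fun z => z.2.1) V₀ V₁ (fun z w v => by
      have h := hM₁ (w, v) z.1 z.2
      have e1 : law p (fun ω => (U ω, V₀ ω, V₁ ω)) (z, w, v) =
          law p (fun ω => ((V₀ ω, V₁ ω), X ω, Y₁ ω, Y₂ ω)) ((w, v), z.1, z.2) :=
        law_congr fun ω => by simp only [hU, Prod.ext_iff]; tauto
      have e2 : law p (fun ω => (((U ω).1, V₀ ω), V₁ ω)) ((z.1, w), v) =
          law p (fun ω => ((V₀ ω, V₁ ω), X ω)) ((w, v), z.1) :=
        law_congr fun ω => by simp only [hU, Prod.mk.injEq]; tauto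
      rw [e1, e2]; exact h) hq₀law rfl
  obtain ⟨K₂, a₂, e₂, b₂, hK₂, ha₂, hab₂, hae₂, hp₂⟩ := exists_receiverKernel hp U Prod.fst
    (fun z => z.2.2) V₀ V₂ (fun z w v => by
      have h := hM₂ (w, v) z.1 z.2
      have e1 : law p (fun ω => (U ω, V₀ ω, V₂ ω)) (z, w, v) =
          law p (fun ω => ((V₀ ω, V₂ ω), X ω, Y₁ ω, Y₂ ω)) ((w, v), z.1, z.2) :=
        law_congr fun ω => by simp only [hU, Prod.ext_iff]; tauto
      have e2 : law p (fun ω => (((U ω).1, V₀ ω), V₂ ω)) ((z.1, w), v) =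
          law p (fun ω => ((V₀ ω, V₂ ω), X ω)) ((w, v), z.1) :=
        law_congr fun ω => by simp only [hU, Prod.mk.injEq]; tauto
      rw [e1, e2]; exact h) hq₀law rfl
  rw [hA.law_source] at hK₁ hK₂ hp₁ hp₂
  refine epsAchievable_of_rateData (hA.law_source ▸ law_mem_stdSimplex hp U) W₁ W₂ hq₀
    (law_mem_stdSimplex hp V₀) hK₁ hK₂ (fun y => ?_) (fun y => ?_) ?_ ha₁ ha₂ hR ?_ ?_ ?_ ?_ hε
  · rw [← hA.law_rec₁]; exact hp₁ y
  · rw [← hA.law_rec₂]; exact hp₂ y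
  -- Here `a₀` is I(X;V₀), which is nonnegative.
  · exact sum_logb_condLaw_nonneg (g := fun _ => law p V₀) hp hq₀law
      (fun _ => law_mem_stdSimplex hp V₀) fun ω hω => law_pos hp V₀ hω
  · rw [hab₁]; exact h1
  · rw [hab₂]; exact h2
  · rw [hae₁]; exact h01
  · rw [hae₂]; exact h02

end Regions

/-! ### Mixtures of finite probability spaces -/

section Mixture

variable {Ω Ω' : Type*} [Fintype Ω] [Fintype Ω'] {α β γ 𝒱₀ 𝒱₀' : Type*}

/-- The mixture of two finite probability spaces with weights `a` and `b`. -/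
def mixture (a b : ℝ) (p : Ω → ℝ) (p' : Ω' → ℝ) : Ω ⊕ Ω' → ℝ :=
  Sum.elim (fun ω => a * p ω) (fun ω => b * p' ω)

variable {a b : ℝ} {p : Ω → ℝ} {p' : Ω' → ℝ}

lemma mixture_mem_stdSimplex (ha : 0 ≤ a) (hb : 0 ≤ b) (hab : a + b = 1)
    (hp : p ∈ stdSimplex ℝ Ω) (hp' : p' ∈ stdSimplex ℝ Ω') :
    mixture a b p p' ∈ stdSimplex ℝ (Ω ⊕ Ω') := by
  refine ⟨?_, ?_⟩
  · rintro (ω | ω)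
    · exact mul_nonneg ha (hp.1 ω)
    · exact mul_nonneg hb (hp'.1 ω)
  · simp [mixture, ← Finset.mul_sum, hp.2, hp'.2, hab]

lemma sum_mixture_mul (F : Ω ⊕ Ω' → ℝ) :
    ∑ ω, mixture a b p p' ω * F ω =
      a * ∑ ω, p ω * F (Sum.inl ω) + b * ∑ ω, p' ω * F (Sum.inr ω) := by
  simp [mixture, Finset.mul_sum, mul_assoc]

lemma law_mixture (A : Ω ⊕ Ω' → α) (x : α) :
    law (mixture a b p p') A x =
      a * law p (fun ω => A (Sum.inl ω)) x + b * law p' (fun ω => A (Sum.inr ω)) x := by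
  simp only [law_eq_sum, sum_mixture_mul]

lemma law_mixture_eq (hab : a + b = 1) {D : Ω ⊕ Ω' → α} {x : α} {E : Ω → β} {E' : Ω' → β} {y : β}
    (h : ∀ ω, D (Sum.inl ω) = x ↔ E ω = y) (h' : ∀ ω, D (Sum.inr ω) = x ↔ E' ω = y)
    (hE : law p E y = law p' E' y) : law (mixture a b p p') D x = law p E y := by
  rw [law_mixture, law_congr h, law_congr h', ← hE, ← add_mul, hab, one_mul]

lemma law_mixture_eq' (hab : a + b = 1) {D : Ω ⊕ Ω' → α} {x : α} {E : Ω → β} {E' : Ω' → β}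
    {y : β} (h : ∀ ω, D (Sum.inl ω) = x ↔ E ω = y) (h' : ∀ ω, D (Sum.inr ω) = x ↔ E' ω = y)
    (hE : law p E y = law p' E' y) : law (mixture a b p p') D x = law p' E' y := by
  rw [law_mixture_eq hab h h' hE, hE]

lemma law_mixture_inl {D : Ω ⊕ Ω' → α} {x : α} {E : Ω → β} {y : β}
    (h : ∀ ω, D (Sum.inl ω) = x ↔ E ω = y) (h' : ∀ ω, D (Sum.inr ω) ≠ x) :
    law (mixture a b p p') D x = a * law p E y := by
  have h0 : law p' (fun ω => D (Sum.inr ω)) x = 0 := by simp [law_eq_sum, ind_false (h' _)]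
  rw [law_mixture, law_congr h, h0, mul_zero, add_zero]

lemma law_mixture_inr {D : Ω ⊕ Ω' → α} {x : α} {E : Ω' → β} {y : β}
    (h : ∀ ω, D (Sum.inr ω) = x ↔ E ω = y) (h' : ∀ ω, D (Sum.inl ω) ≠ x) :
    law (mixture a b p p') D x = b * law p' E y := by
  have h0 : law p (fun ω => D (Sum.inl ω)) x = 0 := by simp [law_eq_sum, ind_false (h' _)]
  rw [law_mixture, law_congr h, h0, mul_zero, zero_add]

variable [Fintype α] [Fintype β] [Fintype γ] [Fintype 𝒱₀] [Fintype 𝒱₀']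

/-- Conditional mutual information given a variable that reveals the component of the mixture. -/
lemma condMutualInfo_mixture (ha : a ≠ 0) (hb : b ≠ 0) (A : Ω → α) (A' : Ω' → α) (B : Ω → β)
    (B' : Ω' → β) (C : Ω → γ) (C' : Ω' → γ) (V₀ : Ω → 𝒱₀) (V₀' : Ω' → 𝒱₀') :
    condMutualInfo (mixture a b p p') (Sum.elim A A') (Sum.elim B B')
        (fun ω => (Sum.map V₀ V₀' ω, Sum.elim C C' ω)) =
      a * condMutualInfo p A B (fun ω => (V₀ ω, C ω)) +
        b * condMutualInfo p' A' B' (fun ω => (V₀' ω, C' ω)) := by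
  simp only [condMutualInfo_eq_sum, sum_mixture_mul, Sum.elim_inl, Sum.elim_inr, Sum.map_inl,
    Sum.map_inr]
  congr 2
  -- All four laws involve the value of `Sum.map V₀ V₀'`, which fixes the component; each carries
  -- the factor `a`, and the factors cancel in the ratio.
  · refine Finset.sum_congr rfl fun ω _ => ?_
    rw [law_mixture_inl (E := fun ω => (A ω, B ω, V₀ ω, C ω)) (y := (A ω, B ω, V₀ ω, C ω))
        (by simp) (by simp),
      law_mixture_inl (E := fun ω => (V₀ ω, C ω)) (y := (V₀ ω, C ω)) (by simp) (by simp),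
      law_mixture_inl (E := fun ω => (A ω, V₀ ω, C ω)) (y := (A ω, V₀ ω, C ω))
        (by simp) (by simp),
      law_mixture_inl (E := fun ω => (B ω, V₀ ω, C ω)) (y := (B ω, V₀ ω, C ω))
        (by simp) (by simp),
      mul_mul_mul_comm, mul_mul_mul_comm a _ a, mul_div_mul_left _ _ (mul_ne_zero ha ha)]
  · refine Finset.sum_congr rfl fun ω _ => ?_
    rw [law_mixture_inr (E := fun ω => (A' ω, B' ω, V₀' ω, C' ω)) (y := (A' ω, B' ω, V₀' ω, C' ω))
        (by simp) (by simp),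
      law_mixture_inr (E := fun ω => (V₀' ω, C' ω)) (y := (V₀' ω, C' ω)) (by simp) (by simp),
      law_mixture_inr (E := fun ω => (A' ω, V₀' ω, C' ω)) (y := (A' ω, V₀' ω, C' ω))
        (by simp) (by simp),
      law_mixture_inr (E := fun ω => (B' ω, V₀' ω, C' ω)) (y := (B' ω, V₀' ω, C' ω))
        (by simp) (by simp),
      mul_mul_mul_comm, mul_mul_mul_comm b _ b, mul_div_mul_left _ _ (mul_ne_zero hb hb)]

/-- Conditional mutual information with a variable that reveals the component of the mixture,
when the components agree on the law of `(A, C)`. -/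
lemma condMutualInfo_mixture_pair (hab : a + b = 1) (ha : a ≠ 0) (hb : b ≠ 0) (A : Ω → α)
    (A' : Ω' → α) (B : Ω → β) (B' : Ω' → β) (C : Ω → γ) (C' : Ω' → γ) (V₀ : Ω → 𝒱₀)
    (V₀' : Ω' → 𝒱₀')
    (hAC : law p (fun ω => (A ω, C ω)) = law p' (fun ω => (A' ω, C' ω)))
    (hC : law p C = law p' C') :
    condMutualInfo (mixture a b p p') (Sum.elim A A')
        (fun ω => (Sum.map V₀ V₀' ω, Sum.elim B B' ω)) (Sum.elim C C') =
      a * condMutualInfo p A (fun ω => (V₀ ω, B ω)) C +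
        b * condMutualInfo p' A' (fun ω => (V₀' ω, B' ω)) C' := by
  simp only [condMutualInfo_eq_sum, sum_mixture_mul, Sum.elim_inl, Sum.elim_inr, Sum.map_inl,
    Sum.map_inr]
  congr 2
  -- Only the two laws that involve V₀ carry the factor `a`. Those of `C` and `(A, C)` are the same
  -- in both components, hence unchanged by mixing.
  · refine Finset.sum_congr rfl fun ω _ => ?_
    rw [law_mixture_inl (E := fun ω => (A ω, (V₀ ω, B ω), C ω)) (y := (A ω, (V₀ ω, B ω), C ω))
        (by simp) (by simp),
      law_mixture_eq hab (E := C) (E' := C') (y := C ω) (by simp) (by simp) (congrFun hC _),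
      law_mixture_eq hab (E := fun ω => (A ω, C ω)) (E' := fun ω => (A' ω, C' ω)) (y := (A ω, C ω))
        (by simp) (by simp) (congrFun hAC _),
      law_mixture_inl (E := fun ω => ((V₀ ω, B ω), C ω)) (y := ((V₀ ω, B ω), C ω))
        (by simp) (by simp),
      mul_assoc, mul_left_comm _ a, mul_div_mul_left _ _ ha]
  · refine Finset.sum_congr rfl fun ω _ => ?_
    rw [law_mixture_inr (E := fun ω => (A' ω, (V₀' ω, B' ω), C' ω))
        (y := (A' ω, (V₀' ω, B' ω), C' ω)) (by simp) (by simp),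
      law_mixture_eq' hab (E := C) (E' := C') (y := C' ω) (by simp) (by simp) (congrFun hC _),
      law_mixture_eq' hab (E := fun ω => (A ω, C ω)) (E' := fun ω => (A' ω, C' ω))
        (y := (A' ω, C' ω)) (by simp) (by simp) (congrFun hAC _),
      law_mixture_inr (E := fun ω => ((V₀' ω, B' ω), C' ω)) (y := ((V₀' ω, B' ω), C' ω))
        (by simp) (by simp),
      mul_assoc, mul_left_comm _ b, mul_div_mul_left _ _ hb]

end Mixture

/-! ### Convexity by time sharing -/

section Convexity

variable {𝒳 𝒴₁ 𝒴₂ 𝒱₁ 𝒱₂ : Type*}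
  [Fintype 𝒳] [Fintype 𝒴₁] [Fintype 𝒴₂] [Fintype 𝒱₁] [Fintype 𝒱₂]
  {P : 𝒳 × 𝒴₁ × 𝒴₂ → ℝ} {W₁ : 𝒳 → 𝒱₁ → ℝ} {W₂ : 𝒳 → 𝒱₂ → ℝ}

/-- Any two auxiliary systems thus agree on the laws of functions of the source, the agreement that
`condMutualInfo_mixture_pair` requires. -/
lemma IsAuxiliary.law_comp {Ω 𝒱₀ β : Type*} [Fintype Ω] {p : Ω → ℝ} {X : Ω → 𝒳} {Y₁ : Ω → 𝒴₁}
    {Y₂ : Ω → 𝒴₂} {V₀ : Ω → 𝒱₀} {V₁ : Ω → 𝒱₁} {V₂ : Ω → 𝒱₂}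
    (h : IsAuxiliary P W₁ W₂ p X Y₁ Y₂ V₀ V₁ V₂) (f : 𝒳 × 𝒴₁ × 𝒴₂ → β) :
    law p (fun ω => f (X ω, Y₁ ω, Y₂ ω)) = law P f := by
  funext b
  rw [LGW.law_comp p (fun ω => (X ω, Y₁ ω, Y₂ ω)), h.law_source, law_eq_sum]

/-- Time sharing: the mixture of two auxiliary variables is an auxiliary variable. -/
lemma IsAuxiliary.mixture {Ω Ω' 𝒱₀ 𝒱₀' : Type*} [Fintype Ω] [Fintype Ω'] {p : Ω → ℝ}
    {p' : Ω' → ℝ} {X : Ω → 𝒳} {Y₁ : Ω → 𝒴₁} {Y₂ : Ω → 𝒴₂} {V₀ : Ω → 𝒱₀} {V₁ : Ω → 𝒱₁}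
    {V₂ : Ω → 𝒱₂} {X' : Ω' → 𝒳} {Y₁' : Ω' → 𝒴₁} {Y₂' : Ω' → 𝒴₂} {V₀' : Ω' → 𝒱₀'} {V₁' : Ω' → 𝒱₁}
    {V₂' : Ω' → 𝒱₂} (h : IsAuxiliary P W₁ W₂ p X Y₁ Y₂ V₀ V₁ V₂)
    (h' : IsAuxiliary P W₁ W₂ p' X' Y₁' Y₂' V₀' V₁' V₂') {a b : ℝ} (ha : 0 ≤ a) (hb : 0 ≤ b)
    (hab : a + b = 1) :
    IsAuxiliary P W₁ W₂ (mixture a b p p') (Sum.elim X X') (Sum.elim Y₁ Y₁') (Sum.elim Y₂ Y₂')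
      (Sum.map V₀ V₀') (Sum.elim V₁ V₁') (Sum.elim V₂ V₂') := by
  have hX : law (LGW.mixture a b p p') (Sum.elim X X') = law P Prod.fst := by
    funext x
    rw [law_mixture]
    simp only [Sum.elim_inl, Sum.elim_inr]
    rw [h.law_comp Prod.fst, h'.law_comp Prod.fst, ← add_mul, hab, one_mul]
  have hXY : law (LGW.mixture a b p p')
      (fun ω => (Sum.elim X X' ω, Sum.elim Y₁ Y₁' ω, Sum.elim Y₂ Y₂' ω)) = P := by
    funext x
    rw [law_mixture]
    simp only [Sum.elim_inl, Sum.elim_inr]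
    rw [h.law_source, h'.law_source, ← add_mul, hab, one_mul]
  refine ⟨mixture_mem_stdSimplex ha hb hab h.pmf h'.pmf, hXY, ?_, ?_, ?_⟩
  · funext x
    rw [law_mixture]
    simp only [Sum.elim_inl, Sum.elim_inr]
    rw [h.law_rec₁, h'.law_rec₁, ← add_mul, hab, one_mul]
  · funext x
    rw [law_mixture]
    simp only [Sum.elim_inl, Sum.elim_inr]
    rw [h.law_rec₂, h'.law_rec₂, ← add_mul, hab, one_mul]
  -- The value `w` belongs to one component, so both laws involving it scale by that component's
  -- weight, while the laws of the source are common. What remains is the Markov identity of that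
  -- component.
  · rintro ⟨w, v₁, v₂⟩ x y
    rw [hX, hXY]
    rcases w with w | w
    · have hm := h.markov (w, v₁, v₂) x y
      rw [h.law_comp Prod.fst, h.law_source] at hm
      rw [law_mixture_inl (E := fun ω => ((V₀ ω, V₁ ω, V₂ ω), X ω, Y₁ ω, Y₂ ω))
          (y := ((w, v₁, v₂), x, y)) (by simp) (by simp),
        law_mixture_inl (E := fun ω => ((V₀ ω, V₁ ω, V₂ ω), X ω))
          (y := ((w, v₁, v₂), x)) (by simp) (by simp), mul_assoc, mul_assoc, hm]
    · have hm := h'.markov (w, v₁, v₂) x y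
      rw [h'.law_comp Prod.fst, h'.law_source] at hm
      rw [law_mixture_inr (E := fun ω => ((V₀' ω, V₁' ω, V₂' ω), X' ω, Y₁' ω, Y₂' ω))
          (y := ((w, v₁, v₂), x, y)) (by simp) (by simp),
        law_mixture_inr (E := fun ω => ((V₀' ω, V₁' ω, V₂' ω), X' ω))
          (y := ((w, v₁, v₂), x)) (by simp) (by simp), mul_assoc, mul_assoc, hm]

/-- Before closure, the mixture of the two auxiliary systems is a witness for the combined triplet,
since its information quantities are the weighted averages. Positive weights suffice for convexity,
and cancelling them in the densities needs them nonzero. -/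
theorem convex_regionInner : Convex ℝ (regionInner P W₁ W₂) := by
  refine Convex.closure (convex_iff_forall_pos.2 ?_)
  rintro R ⟨hR, Ω, 𝒱₀, _, _, p, X, Y₁, Y₂, V₀, V₁, V₂, hA, h1, h2, h01, h02⟩ R' ⟨hR', Ω', 𝒱₀', _, _,
    p', X', Y₁', Y₂', V₀', V₁', V₂', hA', h1', h2', h01', h02'⟩ a b ha hb hab
  refine ⟨⟨?_, ?_, ?_⟩, Ω ⊕ Ω', 𝒱₀ ⊕ 𝒱₀', inferInstance, inferInstance, mixture a b p p', _, _, _,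
    _, _, _, hA.mixture hA' ha.le hb.le hab, ?_, ?_, ?_, ?_⟩
  · exact add_nonneg (mul_nonneg ha.le hR.1) (mul_nonneg hb.le hR'.1)
  · exact add_nonneg (mul_nonneg ha.le hR.2.1) (mul_nonneg hb.le hR'.2.1)
  · exact add_nonneg (mul_nonneg ha.le hR.2.2) (mul_nonneg hb.le hR'.2.2)
  · rw [condMutualInfo_mixture ha.ne' hb.ne']
    exact add_lt_add (mul_lt_mul_of_pos_left h1 ha) (mul_lt_mul_of_pos_left h1' hb)
  · rw [condMutualInfo_mixture ha.ne' hb.ne']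
    exact add_lt_add (mul_lt_mul_of_pos_left h2 ha) (mul_lt_mul_of_pos_left h2' hb)
  · rw [condMutualInfo_mixture_pair hab ha.ne' hb.ne' X X' V₁ V₁' Y₁ Y₁' V₀ V₀'
      ((hA.law_comp fun z => (z.1, z.2.1)).trans (hA'.law_comp fun z => (z.1, z.2.1)).symm)
      ((hA.law_comp fun z => z.2.1).trans (hA'.law_comp fun z => z.2.1).symm)]
    refine (add_lt_add (mul_lt_mul_of_pos_left h01 ha) (mul_lt_mul_of_pos_left h01' hb)).trans_eq ?_
    simp only [Prod.fst_add, Prod.snd_add, Prod.smul_fst, Prod.smul_snd, smul_eq_mul]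
    ring
  · rw [condMutualInfo_mixture_pair hab ha.ne' hb.ne' X X' V₂ V₂' Y₂ Y₂' V₀ V₀'
      ((hA.law_comp fun z => (z.1, z.2.2)).trans (hA'.law_comp fun z => (z.1, z.2.2)).symm)
      ((hA.law_comp fun z => z.2.2).trans (hA'.law_comp fun z => z.2.2).symm)]
    refine (add_lt_add (mul_lt_mul_of_pos_left h02 ha) (mul_lt_mul_of_pos_left h02' hb)).trans_eq ?_
    simp only [Prod.fst_add, Prod.snd_add, Prod.smul_fst, Prod.smul_snd, smul_eq_mul]
    ring

end Convexity

end LGW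

theorem mainTheorem4
    {𝒳 𝒴₁ 𝒴₂ 𝒱₁ 𝒱₂ : Type*}
    [Fintype 𝒳] [Fintype 𝒴₁] [Fintype 𝒴₂] [Fintype 𝒱₁] [Fintype 𝒱₂]
    (P : 𝒳 × 𝒴₁ × 𝒴₂ → ℝ) (hP : P ∈ stdSimplex ℝ (𝒳 × 𝒴₁ × 𝒴₂))
    (W₁ : 𝒳 → 𝒱₁ → ℝ) (hW₁ : ∀ x, W₁ x ∈ stdSimplex ℝ 𝒱₁)
    (W₂ : 𝒳 → 𝒱₂ → ℝ) (hW₂ : ∀ x, W₂ x ∈ stdSimplex ℝ 𝒱₂) :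
    LGW.regionInnerStar P W₁ W₂ ⊆ LGW.regionInner P W₁ W₂ ∧
    LGW.regionInner P W₁ W₂ ⊆ LGW.regionLGW P W₁ W₂ ∧
    Convex ℝ (LGW.regionInner P W₁ W₂) :=
  ⟨LGW.regionInnerStar_subset_regionInner, LGW.regionInner_subset_regionLGW,
    LGW.convex_regionInner⟩
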